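/- Let $\Gamma$ be a countably infinite discrete amenable group and let $f=\sum_{\gamma}f_\gamma\cdot\gamma\in\mathbb{Z}\Gamma$. Write $\mathbb{T}=\mathbb{R}/\mathbb{Z}$ and, for a function $x$ on $\Gamma$ with values in $\mathbb{T}$ or $\mathbb{R}$, put $(\lambda^\gamma x)_\delta=x_{\gamma^{-1}\delta}$ (the left shift) and $(\rho^f x)_\gamma=\sum_{\delta\in\Gamma}f_\delta x_{\gamma\delta}$. Let $X_f=\{x\in\mathbb{T}^\Gamma : \rho^f x=0\}$, a compact left-shift-invariant subgroup of $\mathbb{T}^\Gamma$, and let $\lambda_f$ be the left shift action of $\Gamma$ on $X_f$ (the principal algebraic action defined by $f$). Let $Y_f$ be the set of all $y\in\ell^\infty(\Gamma,\mathbb{R})$ with $0\le y_\gamma<1$ for every $\gamma\in\Gamma$ and $(y_\gamma \bmod 1)_{\gamma\in\Gamma}\in X_f$, let $Z_f=\rho^f(Y_f)\subset\ell^\infty(\Gamma,\mathbb{Z})$, and let $\bar Y_f$, $\bar Z_f$ be the weak$^*$ closures of $Y_f$, $Z_f$ in $\ell^\infty(\Gamma,\mathbb{R})=\ell^1(\Gamma,\mathbb{R})^*$.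 These are weak$^*$-compact and left-shift-invariant; let $\bar\lambda_{\bar Y_f}$ and $\bar\lambda_{\bar Z_f}$ be the left shift actions of $\Gamma$ on them. For a continuous action of $\Gamma$ on a nonempty compact space $X$ the topological entropy is $$\mathrm{h}_{\mathrm{top}}=\sup_{\mathcal U}\,\lim_{F}\,\frac1{|F|}\log N\Bigl(\bigvee_{\gamma\in F}\gamma^{-1}\mathcal U\Bigr)\in[0,\infty],$$ where $\mathcal U$ runs over the open covers of $X$, $N(\cdot)$ is the minimal cardinality of a subcover, and the limit is taken as the nonempty finite set $F\subset\Gamma$ becomes more and more left invariant, i.e. as $|\gamma F\,\triangle\,F|/|F|\to0$ for every $\gamma\in\Gamma$. If $\mathrm{h}_{\mathrm{top}}(\lambda_f)<\infty$, then $$\mathrm{h}_{\mathrm{top}}(\bar\lambda_{\bar Z_f})=\mathrm{h}_{\mathrm{top}}(\bar\lambda_{\bar Y_f})=\mathrm{h}_{\mathrm{top}}(\lambda_f).$$ -/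

import Mathlib

open Filter Topology
open scoped ENNReal Pointwise symmDiff

noncomputable section

/-! ### Amenability and topological entropy -/

open scoped Classical in
/-- The nonempty finite sets `F ⊆ Γ` that are left `(K, ε)`-invariant:
`|γF ∆ F| ≤ ε |F|` for every `γ ∈ K`. -/
def leftInvariantSets {Γ : Type*} [Group Γ] (K : Finset Γ) (ε : ℝ) : Set (Finset Γ) :=
  {F | F.Nonempty ∧ ∀ γ ∈ K, (((γ • F) ∆ F).card : ℝ) ≤ ε * F.card}

/-- Amenability of a discrete group (the left Følner condition). -/
def IsAmenableGroup (Γ : Type*) [Group Γ] : Prop :=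
  ∀ (K : Finset Γ) (ε : ℝ), 0 < ε → (leftInvariantSets K ε).Nonempty

/-- The filter on the finite subsets of `Γ` along which a set becomes more and more left invariant.
A sequence of nonempty finite sets is a left Følner sequence if and only if it tends to
this filter. -/
def leftFolnerFilter (Γ : Type*) [Group Γ] : Filter (Finset Γ) :=
  ⨅ (K : Finset Γ) (ε : ℝ) (_ : 0 < ε), 𝓟 (leftInvariantSets K ε)

/-- `U` is an open cover of the space `X`. -/
def IsOpenCoverOf {X : Type*} [TopologicalSpace X] (U : Set (Set X)) : Prop :=
  (∀ u ∈ U, IsOpen u) ∧ ⋃₀ U = Set.univ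

/-- The minimal cardinality `N(U)` of a subcover of `U` (`⊤` if there is no finite subcover). -/
def minCoverCard {X : Type*} (U : Set (Set X)) : ℕ∞ :=
  ⨅ (V : Finset (Set X)) (_ : (V : Set (Set X)) ⊆ U ∧ ⋃₀ (V : Set (Set X)) = Set.univ),
    (V.card : ℕ∞)

/-- The common refinement `⋁_{γ ∈ F} γ⁻¹ U` of the translates of a cover `U`. -/
def coverJoin {Γ X : Type*} [Group Γ] [MulAction Γ X] (U : Set (Set X)) (F : Finset Γ) :
    Set (Set X) :=
  {s | ∃ φ : Γ → Set X, (∀ γ ∈ F, φ γ ∈ U) ∧ s = ⋂ γ ∈ F, (fun x : X => γ • x) ⁻¹' φ γ}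

/-- The topological entropy of an action of `Γ` on `X`:
`h_top = sup_U lim_F (1/|F|) log N(⋁_{γ ∈ F} γ⁻¹ U)`, where `U` runs over the open covers of `X`
and the limit is taken as `F` becomes more and more left invariant. For amenable `Γ` and compact
`X ≠ ∅` this limit exists, and it is the limit along every left Følner sequence; it is written
here as an upper limit, which needs no existence. -/
def topEntropy (Γ X : Type*) [Group Γ] [MulAction Γ X] [TopologicalSpace X] : EReal :=
  ⨆ (U : Set (Set X)) (_ : IsOpenCoverOf U),
    limsup (fun F : Finset Γ =>
      ENNReal.log ((minCoverCard (coverJoin U F) : ℕ∞) : ℝ≥0∞) / ((F.card : ℝ) : EReal))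
      (leftFolnerFilter Γ)

/-! ### The principal algebraic action -/

/-- The left shift `(λ^γ x)_δ = x_{γ⁻¹δ}` on `A^Γ`. -/
def leftShift {Γ A : Type*} [Group Γ] (γ : Γ) (x : Γ → A) : Γ → A := fun δ => x (γ⁻¹ * δ)

/-- `ρ^f = ∑_δ f_δ ρ^δ`, where `(ρ^δ x)_γ = x_{γδ}`, for `f ∈ ℤΓ`, on `A^Γ` with `A` an
abelian group. -/
def rightConv {Γ A : Type*} [Group Γ] [AddCommGroup A] (f : MonoidAlgebra ℤ Γ) (x : Γ → A) :
    Γ → A :=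
  fun γ => ∑ δ ∈ f.coeff.support, f.coeff δ • x (γ * δ)

/-- `X_f = ker ρ^f ⊆ 𝕋^Γ`, with `𝕋 = ℝ/ℤ`. -/
def Xf {Γ : Type*} [Group Γ] (f : MonoidAlgebra ℤ Γ) : Set (Γ → UnitAddCircle) :=
  {x | rightConv f x = 0}

theorem rightConv_leftShift {Γ A : Type*} [Group Γ] [AddCommGroup A] (f : MonoidAlgebra ℤ Γ)
    (γ : Γ) (x : Γ → A) : rightConv f (leftShift γ x) = leftShift γ (rightConv f x) := by
  funext δ
  simp [rightConv, leftShift, mul_assoc]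

theorem leftShift_one {Γ A : Type*} [Group Γ] (x : Γ → A) : leftShift 1 x = x := by
  funext δ
  simp [leftShift]

theorem leftShift_mul {Γ A : Type*} [Group Γ] (γ γ' : Γ) (x : Γ → A) :
    leftShift (γ * γ') x = leftShift γ (leftShift γ' x) := by
  funext δ
  simp [leftShift, mul_assoc]

theorem leftShift_mem_Xf {Γ : Type*} [Group Γ] {f : MonoidAlgebra ℤ Γ} (γ : Γ)
    {x : Γ → UnitAddCircle} (hx : x ∈ Xf f) : leftShift γ x ∈ Xf f := by
  have h : rightConv f x = 0 := hx
  change rightConv f (leftShift γ x) = 0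
  rw [rightConv_leftShift, h]
  rfl

/-- The principal algebraic action `λ_f`: the left shift on `X_f`. -/
instance Xf.instMulAction {Γ : Type*} [Group Γ] (f : MonoidAlgebra ℤ Γ) :
    MulAction Γ (Xf f) where
  smul γ x := ⟨leftShift γ x.1, leftShift_mem_Xf γ x.2⟩
  one_smul x := Subtype.ext (leftShift_one x.1)
  mul_smul γ γ' x := Subtype.ext (leftShift_mul γ γ' x.1)

/-! ### The space `ℓ^∞(Γ, ℝ)` with its weak* topology -/

/-- `ℓ^∞(Γ, ℝ)`, a type of its own because it carries the weak* topology. -/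
def EllInf (Γ : Type*) : Type _ := {v : Γ → ℝ // Memℓp v ∞}

/-- The weak* topology on `ℓ^∞(Γ, ℝ) = ℓ¹(Γ, ℝ)*`: the coarsest topology for which
`v ↦ ∑_γ h_γ v_γ` is continuous for every `h ∈ ℓ¹(Γ, ℝ)`. -/
instance EllInf.instTopologicalSpace (Γ : Type*) : TopologicalSpace (EllInf Γ) :=
  TopologicalSpace.induced
    (fun v (h : {h : Γ → ℝ // Memℓp h 1}) => ∑' γ, h.1 γ * v.1 γ) inferInstance

theorem memℓp_leftShift {Γ : Type*} [Group Γ] (γ : Γ) {v : Γ → ℝ} (hv : Memℓp v ∞) :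
    Memℓp (leftShift γ v) ∞ := by
  obtain ⟨C, hC⟩ := memℓp_infty_iff.1 hv
  refine memℓp_infty ⟨C, ?_⟩
  rintro _ ⟨δ, rfl⟩
  exact hC ⟨γ⁻¹ * δ, rfl⟩

theorem memℓp_rightConv {Γ : Type*} [Group Γ] (f : MonoidAlgebra ℤ Γ) {v : Γ → ℝ}
    (hv : Memℓp v ∞) : Memℓp (rightConv f v) ∞ := by
  obtain ⟨C, hC⟩ := memℓp_infty_iff.1 hv
  refine memℓp_infty ⟨∑ δ ∈ f.coeff.support, |(f.coeff δ : ℝ)| * C, ?_⟩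
  rintro _ ⟨γ, rfl⟩
  refine (norm_sum_le _ _).trans (Finset.sum_le_sum fun δ _ => ?_)
  rw [zsmul_eq_mul, norm_mul, Real.norm_eq_abs]
  exact mul_le_mul_of_nonneg_left (hC ⟨γ * δ, rfl⟩) (abs_nonneg _)

/-- The left shift action on `ℓ^∞(Γ, ℝ)`. -/
instance EllInf.instMulAction (Γ : Type*) [Group Γ] : MulAction Γ (EllInf Γ) where
  smul γ v := ⟨leftShift γ v.1, memℓp_leftShift γ v.2⟩
  one_smul v := Subtype.ext (leftShift_one v.1)
  mul_smul γ γ' v := Subtype.ext (leftShift_mul γ γ' v.1)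

/-- `ρ̄^f` on `ℓ^∞(Γ, ℝ)`. -/
def rhoBar {Γ : Type*} [Group Γ] (f : MonoidAlgebra ℤ Γ) (v : EllInf Γ) : EllInf Γ :=
  ⟨rightConv f v.1, memℓp_rightConv f v.2⟩

/-- Coordinatewise reduction modulo `1`, from `ℓ^∞(Γ, ℝ)` to `𝕋^Γ`. -/
def etaMap {Γ : Type*} (w : EllInf Γ) : Γ → UnitAddCircle := fun γ => (w.1 γ : UnitAddCircle)

/-- The linearization `W_f = η⁻¹(X_f)`. -/
def Wf {Γ : Type*} [Group Γ] (f : MonoidAlgebra ℤ Γ) : Set (EllInf Γ) := etaMap ⁻¹' Xf f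

/-- `Y_f = W_f ∩ [0,1)^Γ`. -/
def Yf {Γ : Type*} [Group Γ] (f : MonoidAlgebra ℤ Γ) : Set (EllInf Γ) :=
  Wf f ∩ {w | ∀ γ, w.1 γ ∈ Set.Ico (0 : ℝ) 1}

/-- `Z_f = ρ̄^f(Y_f)`. -/
def Zf {Γ : Type*} [Group Γ] (f : MonoidAlgebra ℤ Γ) : Set (EllInf Γ) := rhoBar f '' Yf f

/-- The weak* closure of `Y_f`. -/
def YfBar {Γ : Type*} [Group Γ] (f : MonoidAlgebra ℤ Γ) : Set (EllInf Γ) := closure (Yf f)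

/-- The weak* closure of `Z_f`. -/
def ZfBar {Γ : Type*} [Group Γ] (f : MonoidAlgebra ℤ Γ) : Set (EllInf Γ) := closure (Zf f)

theorem EllInf.continuous_smul {Γ : Type*} [Group Γ] (γ : Γ) :
    Continuous (fun v : EllInf Γ => γ • v) := by
  refine continuous_induced_rng.2 (continuous_pi fun h => ?_)
  have hh : Memℓp (fun δ => h.1 (γ * δ)) 1 := by
    have h1 : (0 : ℝ) < (1 : ℝ≥0∞).toReal := by simp
    rw [memℓp_gen_iff h1]
    exact ((memℓp_gen_iff h1).1 h.2).comp_injective (mul_right_injective γ)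
  have key : ∀ v : EllInf Γ,
      ∑' δ, h.1 δ * (γ • v).1 δ = ∑' δ, h.1 (γ * δ) * v.1 δ := by
    intro v
    rw [← (Equiv.mulLeft γ).tsum_eq (fun δ => h.1 δ * (γ • v).1 δ)]
    refine tsum_congr fun δ => ?_
    change h.1 (γ * δ) * v.1 (γ⁻¹ * (γ * δ)) = _
    rw [inv_mul_cancel_left]
  have hd : Continuous (fun (v : EllInf Γ) (h : {h : Γ → ℝ // Memℓp h 1}) =>
      ∑' δ, h.1 δ * v.1 δ) := continuous_induced_dom
  have hc : Continuous (fun v : EllInf Γ => ∑' δ, h.1 (γ * δ) * v.1 δ) :=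
    (continuous_apply (⟨_, hh⟩ : {h : Γ → ℝ // Memℓp h 1})).comp hd
  exact hc.congr fun v => (key v).symm

theorem smul_mem_Yf {Γ : Type*} [Group Γ] {f : MonoidAlgebra ℤ Γ} (γ : Γ) {v : EllInf Γ}
    (hv : v ∈ Yf f) : γ • v ∈ Yf f :=
  ⟨leftShift_mem_Xf γ (x := etaMap v) hv.1, fun δ => hv.2 (γ⁻¹ * δ)⟩

theorem smul_mem_Zf {Γ : Type*} [Group Γ] {f : MonoidAlgebra ℤ Γ} (γ : Γ) {v : EllInf Γ}
    (hv : v ∈ Zf f) : γ • v ∈ Zf f := by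
  obtain ⟨y, hy, rfl⟩ := hv
  exact ⟨γ • y, smul_mem_Yf γ hy, Subtype.ext (rightConv_leftShift f γ y.1)⟩

theorem smul_mem_YfBar {Γ : Type*} [Group Γ] {f : MonoidAlgebra ℤ Γ} (γ : Γ) {v : EllInf Γ}
    (hv : v ∈ YfBar f) : γ • v ∈ YfBar f :=
  map_mem_closure (EllInf.continuous_smul γ) hv fun _ h => smul_mem_Yf γ h

theorem smul_mem_ZfBar {Γ : Type*} [Group Γ] {f : MonoidAlgebra ℤ Γ} (γ : Γ) {v : EllInf Γ}
    (hv : v ∈ ZfBar f) : γ • v ∈ ZfBar f :=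
  map_mem_closure (EllInf.continuous_smul γ) hv fun _ h => smul_mem_Zf γ h

/-- The left shift action on the weak* closure of `Y_f`. -/
instance YfBar.instMulAction {Γ : Type*} [Group Γ] (f : MonoidAlgebra ℤ Γ) :
    MulAction Γ (YfBar f) where
  smul γ v := ⟨γ • v.1, smul_mem_YfBar γ v.2⟩
  one_smul v := Subtype.ext (one_smul Γ v.1)
  mul_smul γ γ' v := Subtype.ext (mul_smul γ γ' v.1)

/-- The left shift action on the weak* closure of `Z_f`. -/
instance ZfBar.instMulAction {Γ : Type*} [Group Γ] (f : MonoidAlgebra ℤ Γ) :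
    MulAction Γ (ZfBar f) where
  smul γ v := ⟨γ • v.1, smul_mem_ZfBar γ v.2⟩
  one_smul v := Subtype.ext (one_smul Γ v.1)
  mul_smul γ γ' v := Subtype.ext (mul_smul γ γ' v.1)

end

noncomputable section

/-! ### Covers and entropy -/

/-! The entropies satisfy a cycle of inequalities, `X_f` ≤ closure of `Y_f` ≤ closure of `Z_f` ≤
`X_f`. The first holds because reduction mod 1 is a factor map
(`topEntropy_Xf_le_topEntropy_YfBar`). The other two compare covers up to a factor `exp (δ |F|)`,
which entropy does not see (`topEntropy_le_of_forall_cover`).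

Finite entropy is used once, in `eventually_finrank_kerOn_le`: the real functions on `F⁻¹ * K` that
`ρ^f` kills on `F⁻¹` form a space of dimension `o(|F|)`. Up to a boundary term these are finitely
supported elements of `ker ρ^f`. Reduction mod 1 embeds a small ball of that kernel isometrically in
`X_f`, and covering a `d`-dimensional ball at scale `ε` costs about `(1/ε)^d` sets. A finite entropy
bound that holds at every scale `ε` forces `d = o(|F|)`.

From `Y_f` to `Z_f`: points with the same image under `ρ^f` on `F⁻¹` differ by a bounded element of
this space, whose unit ball has an `ε`-net of size `exp (o(|F|))`.

From `Z_f` to `X_f`: if `y, y'` in `Y_f` are close mod 1, then `y' = y + w + m` with `w` small and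
`m` integral. Here `ρ^f w` is integral and small, hence zero, so `ρ^f y' - ρ^f y = ρ^f m`. The carry
`m` depends only on where `w` crosses the thresholds `-y` and `1 - y`. By Sauer–Shelah
(`card_thresholdSets_le`) a space of dimension `o(|F|)` realizes only `exp (o(|F|))` such patterns.
-/

theorem minCoverCard_le_of_subcover {X : Type*} {C : Set (Set X)} (V : Finset (Set X))
    (hV : (V : Set (Set X)) ⊆ C) (hc : ⋃₀ (V : Set (Set X)) = Set.univ) :
    minCoverCard C ≤ V.card :=
  iInf₂_le V ⟨hV, hc⟩

theorem exists_subcover_card_eq_minCoverCard {X : Type*} {C : Set (Set X)}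
    (h : minCoverCard C ≠ ⊤) : ∃ V : Finset (Set X), (V : Set (Set X)) ⊆ C ∧
      ⋃₀ (V : Set (Set X)) = Set.univ ∧ minCoverCard C = V.card := by
  have hlt : minCoverCard C < minCoverCard C + 1 := by
    obtain ⟨n, hn⟩ := ENat.ne_top_iff_exists.1 h
    rw [← hn]
    exact_mod_cast Nat.lt_succ_self n
  obtain ⟨V, hV⟩ := iInf_lt_iff.1 hlt
  obtain ⟨hVC, hlt'⟩ := iInf_lt_iff.1 hV
  exact ⟨V, hVC.1, hVC.2,
    le_antisymm (minCoverCard_le_of_subcover V hVC.1 hVC.2) ((ENat.lt_add_one_iff h).1 hlt')⟩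

-- The pieces need not be open or belong to `C`; choosing one member of `C` around each nonempty
-- piece already gives a subcover.
open scoped Classical in
theorem minCoverCard_le_card_mul {X ι κ : Type*} {C : Set (Set X)} (V : Finset ι)
    (J : ι → Finset κ) (T : ι → κ → Set X) (Q : ℝ) (hQ : ∀ i ∈ V, ((J i).card : ℝ) ≤ Q)
    (hT : ∀ x, ∃ i ∈ V, ∃ j ∈ J i, x ∈ T i j)
    (h : ∀ i ∈ V, ∀ j ∈ J i, (T i j).Nonempty → ∃ s ∈ C, T i j ⊆ s) :
    ((minCoverCard C : ℕ∞) : ℝ≥0∞) ≤ (V.card : ℝ≥0∞) * ENNReal.ofReal Q := by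
  let P : Finset (Σ _ : ι, κ) := (V.sigma J).filter fun p => (T p.1 p.2).Nonempty
  have hP : ∀ p ∈ P, ∃ s ∈ C, T p.1 p.2 ⊆ s := by
    intro p hp
    obtain ⟨hp1, hp2⟩ := Finset.mem_filter.1 hp
    obtain ⟨h1, h2⟩ := Finset.mem_sigma.1 hp1
    exact h _ h1 _ h2 hp2
  choose! s hsC hTs using hP
  have hcard : minCoverCard C ≤ ((P.image s).card : ℕ∞) := by
    refine minCoverCard_le_of_subcover _ ?_ ?_
    · intro t ht
      obtain ⟨p, hp, rfl⟩ := Finset.mem_image.1 (Finset.mem_coe.1 ht)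
      exact hsC p hp
    · refine Set.eq_univ_of_forall fun x => ?_
      obtain ⟨i, hi, j, hj, hx⟩ := hT x
      have hp : (⟨i, j⟩ : Σ _ : ι, κ) ∈ P :=
        Finset.mem_filter.2 ⟨Finset.mem_sigma.2 ⟨hi, hj⟩, ⟨x, hx⟩⟩
      exact ⟨s ⟨i, j⟩, Finset.mem_coe.2 (Finset.mem_image_of_mem _ hp), hTs _ hp hx⟩
  have h2 : (P.image s).card ≤ ∑ i ∈ V, (J i).card := by
    rw [← Finset.card_sigma]
    exact Finset.card_image_le.trans (Finset.card_filter_le _ _)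
  have h3 : ((∑ i ∈ V, (J i).card : ℕ) : ℝ) ≤ V.card * Q := by
    push_cast
    calc ∑ i ∈ V, ((J i).card : ℝ) ≤ ∑ _i ∈ V, Q := Finset.sum_le_sum hQ
      _ = V.card * Q := by rw [Finset.sum_const, nsmul_eq_mul]
  calc ((minCoverCard C : ℕ∞) : ℝ≥0∞) ≤ (((P.image s).card : ℕ∞) : ℝ≥0∞) := by
        exact_mod_cast hcard
    _ ≤ ((∑ i ∈ V, (J i).card : ℕ) : ℝ≥0∞) := by rw [ENat.toENNReal_coe]; exact Nat.cast_le.2 h2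
    _ = ENNReal.ofReal ((∑ i ∈ V, (J i).card : ℕ) : ℝ) := (ENNReal.ofReal_natCast _).symm
    _ ≤ ENNReal.ofReal (V.card * Q) := ENNReal.ofReal_le_ofReal h3
    _ = _ := by rw [ENNReal.ofReal_mul (Nat.cast_nonneg _), ENNReal.ofReal_natCast]

/-- Without a finite subcover of `D` the right side is `⊤`, since `Q > 0`; otherwise the minimum is
attained. -/
theorem minCoverCard_le_mul_of_subcovers {X Y : Type*} {C : Set (Set X)} {D : Set (Set Y)}
    {Q : ℝ} (hQ : 0 < Q) (h : ∀ V : Finset (Set Y), (V : Set (Set Y)) ⊆ D →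
      ⋃₀ (V : Set (Set Y)) = Set.univ →
      ((minCoverCard C : ℕ∞) : ℝ≥0∞) ≤ (V.card : ℝ≥0∞) * ENNReal.ofReal Q) :
    ((minCoverCard C : ℕ∞) : ℝ≥0∞) ≤
      ((minCoverCard D : ℕ∞) : ℝ≥0∞) * ENNReal.ofReal Q := by
  by_cases hD : minCoverCard D = ⊤
  · rw [hD]
    simp [ENNReal.top_mul, hQ]
  · obtain ⟨V, h1, h2, h3⟩ := exists_subcover_card_eq_minCoverCard hD
    rw [h3]
    exact_mod_cast h V h1 h2

theorem eventually_leftInvariantSets {Γ : Type*} [Group Γ] (K : Finset Γ) {ε : ℝ} (hε : 0 < ε) :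
    ∀ᶠ F in leftFolnerFilter Γ, F ∈ leftInvariantSets K ε :=
  mem_iInf_of_mem K (mem_iInf_of_mem ε (mem_iInf_of_mem hε (mem_principal_self _)))

theorem eventually_nonempty_leftFolnerFilter (Γ : Type*) [Group Γ] :
    ∀ᶠ F in leftFolnerFilter Γ, F.Nonempty :=
  (eventually_leftInvariantSets ∅ one_pos).mono fun _ h => h.1

theorem EReal.limsup_le_limsup_of_forall_add {α : Type*} {l : Filter α} {u v : α → EReal}
    (h : ∀ δ : ℝ, 0 < δ → ∀ᶠ a in l, u a ≤ v a + δ) : limsup u l ≤ limsup v l := by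
  refine EReal.le_of_forall_lt_iff_le.1 fun z hz => ?_
  obtain ⟨b, hb1, hb2⟩ := EReal.lt_iff_exists_real_btwn.1 hz
  have hbz : b < z := by exact_mod_cast hb2
  refine limsup_le_of_le (by isBoundedDefault) ?_
  filter_upwards [h (z - b) (by linarith), eventually_lt_of_limsup_lt hb1] with a ha hv
  calc u a ≤ v a + ((z - b : ℝ) : EReal) := ha
    _ ≤ (b : EReal) + ((z - b : ℝ) : EReal) := by gcongr
    _ = z := by rw [← EReal.coe_add]; congr 1; ring

/-- After the logarithm and division by `|F|` the overcount becomes the additive error `δ`. The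
cover `V` must not depend on `δ`. -/
theorem topEntropy_le_of_forall_cover {Γ X Y : Type*} [Group Γ] [MulAction Γ X]
    [TopologicalSpace X] [MulAction Γ Y] [TopologicalSpace Y]
    (h : ∀ U : Set (Set X), IsOpenCoverOf U → ∃ V : Set (Set Y), IsOpenCoverOf V ∧
      ∀ δ : ℝ, 0 < δ → ∀ᶠ F in leftFolnerFilter Γ,
        ((minCoverCard (coverJoin U F) : ℕ∞) : ℝ≥0∞) ≤
          ((minCoverCard (coverJoin V F) : ℕ∞) : ℝ≥0∞) *
            ENNReal.ofReal (Real.exp (δ * F.card))) :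
    topEntropy Γ X ≤ topEntropy Γ Y := by
  refine iSup₂_le fun U hU => ?_
  obtain ⟨V, hV, hUV⟩ := h U hU
  refine le_trans ?_ (le_iSup₂ (f := fun (U : Set (Set Y)) (_ : IsOpenCoverOf U) =>
    limsup (fun F : Finset Γ =>
      ENNReal.log ((minCoverCard (coverJoin U F) : ℕ∞) : ℝ≥0∞) / ((F.card : ℝ) : EReal))
      (leftFolnerFilter Γ)) V hV)
  refine EReal.limsup_le_limsup_of_forall_add fun δ hδ => ?_
  filter_upwards [hUV δ hδ, eventually_nonempty_leftFolnerFilter Γ] with F hF hne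
  have hpos : (0 : ℝ) < F.card := by exact_mod_cast hne.card_pos
  have hnn : (0 : EReal) ≤ ((F.card : ℝ) : EReal) := by exact_mod_cast hpos.le
  refine (EReal.div_le_div_right_of_nonneg hnn (ENNReal.log_monotone hF)).trans ?_
  rw [ENNReal.log_mul_add, EReal.add_div_of_nonneg_right hnn,
    ENNReal.log_ofReal_of_pos (Real.exp_pos _), Real.log_exp, ← EReal.coe_div,
    mul_div_cancel_right₀ _ hpos.ne']

theorem exists_eq_preimage_of_mem_coverJoin {Γ X Y : Type*} [Group Γ] [MulAction Γ X]
    [MulAction Γ Y] (π : Y → X) (hπ : ∀ (γ : Γ) y, π (γ • y) = γ • π y) (U : Set (Set X)) (F : Finset Γ)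
    {s : Set Y} (hs : s ∈ coverJoin ((fun u => π ⁻¹' u) '' U) F) :
    ∃ t ∈ coverJoin U F, s = π ⁻¹' t := by
  obtain ⟨φ, hφ, rfl⟩ := hs
  choose! ψ hψ hψφ using hφ
  refine ⟨_, ⟨ψ, hψ, rfl⟩, ?_⟩
  simp only [Set.preimage_iInter]
  refine Set.iInter₂_congr fun γ hγ => ?_
  rw [← hψφ γ hγ]
  ext y
  simp [hπ]

/-- The entropy of a factor is at most that of the extension. -/
theorem topEntropy_le_of_factor {Γ X Y : Type*} [Group Γ] [MulAction Γ X] [TopologicalSpace X]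
    [MulAction Γ Y] [TopologicalSpace Y] (π : Y → X) (hc : Continuous π)
    (hsurj : Function.Surjective π) (hπ : ∀ (γ : Γ) y, π (γ • y) = γ • π y) :
    topEntropy Γ X ≤ topEntropy Γ Y := by
  refine topEntropy_le_of_forall_cover fun U hU =>
    ⟨(fun u => π ⁻¹' u) '' U, ⟨?_, ?_⟩, fun δ hδ => Eventually.of_forall fun F => ?_⟩
  · rintro _ ⟨u, hu, rfl⟩
    exact (hU.1 u hu).preimage hc
  · refine Set.eq_univ_of_forall fun y => ?_
    obtain ⟨u, hu, hyu⟩ : π y ∈ ⋃₀ U := hU.2 ▸ Set.mem_univ _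
    exact ⟨_, ⟨u, hu, rfl⟩, hyu⟩
  · refine minCoverCard_le_mul_of_subcovers (Real.exp_pos _) fun V hV hcov => ?_
    have hex : ∀ v ∈ V, ∃ t ∈ coverJoin U F, v = π ⁻¹' t := fun v hv =>
      exists_eq_preimage_of_mem_coverJoin π hπ U F (hV hv)
    choose! t ht hvt using hex
    refine minCoverCard_le_card_mul V (fun _ => {()}) (fun v _ => t v) _ (fun _ _ => ?_)
      (fun x => ?_) fun v hv _ _ _ => ⟨t v, ht v hv, le_rfl⟩
    · simpa using mul_nonneg hδ.le (Nat.cast_nonneg F.card)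
    · obtain ⟨y, rfl⟩ := hsurj x
      obtain ⟨v, hv, hyv⟩ : y ∈ ⋃₀ (V : Set (Set Y)) := hcov ▸ Set.mem_univ _
      refine ⟨v, hv, (), by simp, ?_⟩
      rw [hvt v hv] at hyv
      exact hyv

/-! ### Counting in finite-dimensional spaces -/

section Counting

open MeasureTheory

/-- Volume comparison: each `T i` lies in an `ε`-ball about any of its points. Only subadditivity is
used, so no measurability of `T i` is needed. -/
theorem pow_le_card_mul_pow_of_closedBall_subset {E ι : Type*} [NormedAddCommGroup E]
    [NormedSpace ℝ E] [FiniteDimensional ℝ E] {r ε : ℝ} (hr : 0 ≤ r) (hε : 0 ≤ ε)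
    (V : Finset ι) (T : ι → Set E) (hcov : Metric.closedBall 0 r ⊆ ⋃ i ∈ V, T i)
    (hT : ∀ i ∈ V, ∀ x ∈ T i, ∀ y ∈ T i, dist x y ≤ ε) :
    r ^ Module.finrank ℝ E ≤ V.card * ε ^ Module.finrank ℝ E := by
  let _ : MeasurableSpace E := borel E
  have _ : BorelSpace E := ⟨rfl⟩
  let μ : Measure E := Measure.addHaar
  have hball : ∀ i ∈ V, μ (T i) ≤ ENNReal.ofReal (ε ^ Module.finrank ℝ E) *
      μ (Metric.ball 0 1) := by
    intro i hi
    rcases (T i).eq_empty_or_nonempty with h | ⟨x, hx⟩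
    · simp [h]
    · rw [← Measure.addHaar_closedBall μ x hε]
      exact measure_mono fun y hy => Metric.mem_closedBall.2 (hT i hi y hy x hx)
  have hle : ENNReal.ofReal (r ^ Module.finrank ℝ E) * μ (Metric.ball 0 1) ≤
      ENNReal.ofReal (V.card * ε ^ Module.finrank ℝ E) * μ (Metric.ball 0 1) := by
    rw [← Measure.addHaar_closedBall μ 0 hr]
    calc μ (Metric.closedBall 0 r) ≤ μ (⋃ i ∈ V, T i) := measure_mono hcov
      _ ≤ ∑ i ∈ V, μ (T i) := measure_biUnion_finset_le _ _
      _ ≤ ∑ _i ∈ V, ENNReal.ofReal (ε ^ Module.finrank ℝ E) * μ (Metric.ball 0 1) :=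
        Finset.sum_le_sum hball
      _ = _ := by
        rw [Finset.sum_const, nsmul_eq_mul, ENNReal.ofReal_mul (Nat.cast_nonneg _),
          ENNReal.ofReal_natCast, mul_assoc]
  have h0 : μ (Metric.ball 0 1) ≠ 0 := (Metric.measure_ball_pos μ 0 one_pos).ne'
  have htop : μ (Metric.ball 0 1) ≠ ⊤ := measure_ball_lt_top.ne
  rw [ENNReal.mul_le_mul_iff_left h0 htop] at hle
  exact (ENNReal.ofReal_le_ofReal_iff (by positivity)).1 hle

/-- Volume packing: the balls of radius `ε / 2` about the points are disjoint and lie in the ball of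
radius `1 + ε / 2`. -/
theorem card_le_of_separated_closedBall {E : Type*} [NormedAddCommGroup E]
    [NormedSpace ℝ E] [FiniteDimensional ℝ E] {ε : ℝ} (hε : 0 < ε) (D : Finset E)
    (hD : ∀ x ∈ D, ‖x‖ ≤ 1) (hsep : ∀ x ∈ D, ∀ y ∈ D, x ≠ y → ε ≤ dist x y) :
    (D.card : ℝ) ≤ (1 + 2 / ε) ^ Module.finrank ℝ E := by
  let _ : MeasurableSpace E := borel E
  have _ : BorelSpace E := ⟨rfl⟩
  let μ : Measure E := Measure.addHaar
  have hε2 : 0 < ε / 2 := half_pos hε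
  have hdisj : (D : Set E).PairwiseDisjoint fun x => Metric.ball x (ε / 2) := by
    intro x hx y hy hxy
    refine Metric.ball_disjoint_ball ?_
    rw [add_halves]
    exact hsep x hx y hy hxy
  have hsub : (⋃ x ∈ D, Metric.ball x (ε / 2)) ⊆ Metric.ball (0 : E) (1 + ε / 2) := by
    intro z hz
    obtain ⟨x, hx, hzx⟩ := Set.mem_iUnion₂.1 hz
    rw [mem_ball_zero_iff]
    have h1 : ‖z - x‖ < ε / 2 := by rwa [← dist_eq_norm]
    calc ‖z‖ = ‖x + (z - x)‖ := by rw [add_sub_cancel]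
      _ ≤ ‖x‖ + ‖z - x‖ := norm_add_le _ _
      _ < 1 + ε / 2 := add_lt_add_of_le_of_lt (hD x hx) h1
  have hle := measure_mono (μ := μ) hsub
  rw [measure_biUnion_finset hdisj fun x _ => measurableSet_ball] at hle
  simp only [Measure.addHaar_ball_of_pos μ _ hε2] at hle
  rw [Measure.addHaar_ball_of_pos μ _ (r := 1 + ε / 2) (by positivity), Finset.sum_const,
    nsmul_eq_mul, ← mul_assoc, ← ENNReal.ofReal_natCast, ← ENNReal.ofReal_mul (Nat.cast_nonneg _)] at hle
  have h0 : μ (Metric.ball 0 1) ≠ 0 := (Metric.measure_ball_pos μ 0 one_pos).ne'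
  have htop : μ (Metric.ball 0 1) ≠ ⊤ := measure_ball_lt_top.ne
  rw [ENNReal.mul_le_mul_iff_left h0 htop, ENNReal.ofReal_le_ofReal_iff (by positivity)] at hle
  have heq : (1 + ε / 2) = (1 + 2 / ε) * (ε / 2) := by field_simp; ring
  rw [heq, mul_pow] at hle
  exact le_of_mul_le_mul_right hle (by positivity)

/-- A set whose points map into the unit ball of a finite-dimensional space contains a finite
set that is `ε`-dense for the pulled back distance. -/
theorem exists_finset_dense_of_finrank {X E : Type*} [NormedAddCommGroup E]
    [NormedSpace ℝ E] [FiniteDimensional ℝ E] {ε : ℝ} (hε : 0 < ε) (T : Set X) (g : X → E)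
    (hg : ∀ x ∈ T, ‖g x‖ ≤ 1) : ∃ D : Finset X, (D : Set X) ⊆ T ∧
      (D.card : ℝ) ≤ (1 + 2 / ε) ^ Module.finrank ℝ E ∧
      ∀ x ∈ T, ∃ d ∈ D, dist (g x) (g d) < ε := by
  classical
  let p : ℕ → Prop := fun n => ∃ D : Finset X, (D : Set X) ⊆ T ∧
    (∀ x ∈ D, ∀ y ∈ D, x ≠ y → ε ≤ dist (g x) (g y)) ∧ D.card = n
  have hcard : ∀ D : Finset X, (D : Set X) ⊆ T →
      (∀ x ∈ D, ∀ y ∈ D, x ≠ y → ε ≤ dist (g x) (g y)) →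
      (D.card : ℝ) ≤ (1 + 2 / ε) ^ Module.finrank ℝ E := by
    intro D hDT hsep
    have hinj : Set.InjOn g D := by
      intro x hx y hy hxy
      by_contra hne
      have := hsep x hx y hy hne
      rw [hxy, dist_self] at this
      exact absurd this (not_le.2 hε)
    rw [← Finset.card_image_of_injOn hinj]
    refine card_le_of_separated_closedBall hε _ ?_ ?_
    · intro _ hgx
      obtain ⟨x, hx, rfl⟩ := Finset.mem_image.1 hgx
      exact hg x (hDT hx)
    · intro _ hgx _ hgy hxy
      obtain ⟨x, hx, rfl⟩ := Finset.mem_image.1 hgx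
      obtain ⟨y, hy, rfl⟩ := Finset.mem_image.1 hgy
      exact hsep x hx y hy fun h => hxy (h ▸ rfl)
  -- The packing bound caps the size of separated sets, so one of maximal size exists; maximality
  -- makes it `ε`-dense.
  let B := ⌊(1 + 2 / ε) ^ Module.finrank ℝ E⌋₊
  have h0 : p 0 := ⟨∅, by simp, by simp, rfl⟩
  obtain ⟨D, hDT, hsep, hDc⟩ := Nat.findGreatest_spec (P := p) (Nat.zero_le B) h0
  refine ⟨D, hDT, hcard D hDT hsep, fun x hx => ?_⟩
  by_contra! hfar
  have hxD : x ∉ D := fun hxD => by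
    have := hfar x hxD
    rw [dist_self] at this
    exact absurd this (not_le.2 hε)
  have hT' : ((insert x D : Finset X) : Set X) ⊆ T := by
    rw [Finset.coe_insert]
    exact Set.insert_subset hx hDT
  have hsep' : ∀ y ∈ insert x D, ∀ z ∈ insert x D, y ≠ z → ε ≤ dist (g y) (g z) := by
    intro y hy z hz hyz
    rcases Finset.mem_insert.1 hy with hyx | hyD <;>
      rcases Finset.mem_insert.1 hz with hzx | hzD
    · exact absurd (hyx.trans hzx.symm) hyz
    · exact hyx ▸ hfar z hzD
    · rw [dist_comm, hzx]
      exact hfar y hyD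
    · exact hsep y hyD z hzD hyz
  have hle : D.card + 1 ≤ Nat.findGreatest p B := by
    refine Nat.le_findGreatest ?_ ⟨insert x D, hT', hsep', Finset.card_insert_of_notMem hxD⟩
    have := hcard _ hT' hsep'
    rw [Finset.card_insert_of_notMem hxD] at this
    exact Nat.le_floor this
  omega

/-! ### Threshold sets of a space of functions -/

open scoped Classical in
/-- The sets `{a | t a ≤ w a}` for `w` in a space of functions. -/
def thresholdSets {α : Type*} [Fintype α] (W : Submodule ℝ (α → ℝ)) (t : α → ℝ) :
    Finset (Finset α) :=
  Finset.univ.filter fun s => ∃ w ∈ W, s = Finset.univ.filter fun a => t a ≤ w a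

-- If restriction to `B` were not onto, some `c ≠ 0` would annihilate all restrictions. Shattering
-- gives `w` above `t` exactly where `c > 0` and `w'` above `t` exactly where `c < 0`. Then every `c
-- b * (w b - w' b)` is nonnegative with sum zero, which fails where `c b ≠ 0`.
open scoped Classical in
theorem card_le_finrank_of_shatters_thresholdSets {α : Type*} [Fintype α]
    (W : Submodule ℝ (α → ℝ)) (t : α → ℝ) {B : Finset α} (hB : (thresholdSets W t).Shatters B) :
    B.card ≤ Module.finrank ℝ W := by
  have hpat : ∀ C ⊆ B, ∃ w ∈ W, ∀ b ∈ B, b ∈ C ↔ t b ≤ w b := by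
    intro C hC
    obtain ⟨u, hu, hBu⟩ := hB hC
    obtain ⟨w, hw, rfl⟩ := (Finset.mem_filter.1 hu).2
    refine ⟨w, hw, fun b hb => ?_⟩
    rw [← hBu]
    simp [hb]
  let R : W →ₗ[ℝ] (B → ℝ) := (LinearMap.funLeft ℝ ℝ (Subtype.val : B → α)) ∘ₗ W.subtype
  suffices hR : Function.Surjective R by
    have := LinearMap.finrank_le_finrank_of_surjective hR
    simpa using this
  by_contra hns
  obtain ⟨φ, hφ0, hφ⟩ := Submodule.exists_le_ker_of_lt_top (LinearMap.range R)
    (lt_top_iff_ne_top.2 fun h => hns (LinearMap.range_eq_top.1 h))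
  let c : B → ℝ := fun b => φ (Pi.single b 1)
  have hφc : ∀ v : B → ℝ, φ v = ∑ b, c b * v b := by
    intro v
    conv_lhs => rw [LinearMap.pi_apply_eq_sum_univ φ v]
    refine Finset.sum_congr rfl fun b _ => ?_
    rw [smul_eq_mul, mul_comm]
    congr 2
    funext j
    simp [Pi.single_apply, eq_comm]
  have hzero : ∀ w ∈ W, ∑ b : B, c b * w b = 0 := by
    intro w hw
    have := hφ (LinearMap.mem_range_self R ⟨w, hw⟩)
    rw [LinearMap.mem_ker, hφc] at this
    exact this
  obtain ⟨b₀, hb₀⟩ : ∃ b, c b ≠ 0 := by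
    by_contra! h
    exact hφ0 (LinearMap.ext fun v => by simp [hφc, h])
  obtain ⟨w, hw, hwB⟩ := hpat (B.filter fun b => ∃ h : b ∈ B, 0 < c ⟨b, h⟩)
    (Finset.filter_subset _ _)
  obtain ⟨w', hw', hwB'⟩ := hpat (B.filter fun b => ∃ h : b ∈ B, c ⟨b, h⟩ < 0)
    (Finset.filter_subset _ _)
  have hiff : ∀ b : B, 0 < c b ↔ t b ≤ w b := fun b => by
    rw [← hwB b b.2]
    simp
  have hiff' : ∀ b : B, c b < 0 ↔ t b ≤ w' b := fun b => by
    rw [← hwB' b b.2]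
    simp
  have hterm : ∀ b : B, 0 ≤ c b * (w b - w' b) := by
    intro b
    rcases lt_trichotomy (c b) 0 with h | h | h
    · have h1 := (hiff' b).1 h
      have h2 := not_le.1 (fun hh => absurd ((hiff b).2 hh) (not_lt.2 h.le))
      exact mul_nonneg_of_nonpos_of_nonpos h.le (by linarith)
    · simp [h]
    · have h1 := (hiff b).1 h
      have h2 := not_le.1 (fun hh => absurd ((hiff' b).2 hh) (not_lt.2 h.le))
      exact mul_nonneg h.le (by linarith)
  have hsum : ∑ b : B, c b * (w b - w' b) = 0 := by
    simp only [mul_sub, Finset.sum_sub_distrib, hzero w hw, hzero w' hw', sub_zero]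
  have hb := (Finset.sum_eq_zero_iff_of_nonneg fun b _ => hterm b).1 hsum b₀ (Finset.mem_univ _)
  have heq : w b₀ = w' b₀ := sub_eq_zero.1 ((mul_eq_zero.1 hb).resolve_left hb₀)
  rcases lt_or_gt_of_ne hb₀ with h | h
  · have := (hiff' b₀).1 h
    rw [← heq] at this
    exact absurd ((hiff b₀).2 this) (not_lt.2 h.le)
  · have := (hiff b₀).1 h
    rw [heq] at this
    exact absurd ((hiff' b₀).2 this) (not_lt.2 h.le)

/-- As `t ≤ 1`, `t ^ d ≤ t ^ k` for `k ≤ d`; the binomial theorem bounds the rest. -/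
theorem sum_choose_mul_pow_le (n d : ℕ) {t : ℝ} (ht : 0 < t) (ht1 : t ≤ 1) :
    (∑ k ∈ Finset.Iic d, (n.choose k : ℝ)) * t ^ d ≤ (1 + t) ^ n := by
  have h1 : (∑ k ∈ Finset.Iic d, (n.choose k : ℝ)) * t ^ d ≤
      ∑ k ∈ Finset.Iic d, (n.choose k : ℝ) * t ^ k := by
    rw [Finset.sum_mul]
    refine Finset.sum_le_sum fun k hk => ?_
    exact mul_le_mul_of_nonneg_left (pow_le_pow_of_le_one ht.le ht1 (Finset.mem_Iic.1 hk))
      (Nat.cast_nonneg _)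
  refine h1.trans ?_
  rw [add_comm, add_pow]
  simp only [one_pow, mul_one]
  calc ∑ k ∈ Finset.Iic d, (n.choose k : ℝ) * t ^ k
      -- `d` may exceed `n`, so neither index set need contain the other.
      ≤ ∑ k ∈ Finset.Iic d ∪ Finset.range (n + 1), (n.choose k : ℝ) * t ^ k :=
        Finset.sum_le_sum_of_subset_of_nonneg Finset.subset_union_left
          fun _ _ _ => by positivity
    _ = ∑ k ∈ Finset.range (n + 1), (n.choose k : ℝ) * t ^ k := by
        refine (Finset.sum_subset Finset.subset_union_right fun k _ hk => ?_).symm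
        rw [Nat.choose_eq_zero_of_lt (by simpa using hk)]
        simp
    _ = _ := Finset.sum_congr rfl fun k _ => mul_comm _ _

/-- Sauer–Shelah bound for the threshold sets of a finite-dimensional space of functions. -/
theorem card_thresholdSets_le {α : Type*} [Fintype α] (W : Submodule ℝ (α → ℝ)) (t : α → ℝ)
    {τ : ℝ} (hτ : 0 < τ) (hτ1 : τ ≤ 1) :
    ((thresholdSets W t).card : ℝ) ≤
      Real.exp (τ * Fintype.card α + Module.finrank ℝ W * Real.log (1 / τ)) := by
  classical
  have hvc : (thresholdSets W t).vcDim ≤ Module.finrank ℝ W :=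
    Finset.sup_le fun B hB =>
      card_le_finrank_of_shatters_thresholdSets W t
        (by convert (Finset.mem_shatterer.1 hB))
  have h1 : (thresholdSets W t).card ≤
      ∑ k ∈ Finset.Iic (Module.finrank ℝ W), (Fintype.card α).choose k :=
    (Finset.card_le_card_shatterer _).trans (Finset.card_shatterer_le_sum_vcDim.trans
      (Finset.sum_le_sum_of_subset (Finset.Iic_subset_Iic.2 hvc)))
  have h2 := sum_choose_mul_pow_le (Fintype.card α) (Module.finrank ℝ W) hτ hτ1
  have h3 : (1 + τ) ^ Fintype.card α ≤ Real.exp (τ * Fintype.card α) := by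
    rw [mul_comm, Real.exp_nat_mul]
    refine pow_le_pow_left₀ (by positivity) ?_ _
    rw [add_comm]
    exact Real.add_one_le_exp τ
  have h4 : Real.exp (Module.finrank ℝ W * Real.log (1 / τ)) * τ ^ Module.finrank ℝ W = 1 := by
    rw [Real.exp_nat_mul, Real.exp_log (by positivity), ← mul_pow, one_div,
      inv_mul_cancel₀ hτ.ne', one_pow]
  have h5 : ((thresholdSets W t).card : ℝ) * τ ^ Module.finrank ℝ W ≤
      Real.exp (τ * Fintype.card α) := by
    refine le_trans ?_ (h2.trans h3)
    refine mul_le_mul_of_nonneg_right ?_ (by positivity)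
    exact_mod_cast h1
  rw [Real.exp_add]
  refine le_of_mul_le_mul_right (a := τ ^ Module.finrank ℝ W) ?_ (by positivity)
  rw [mul_assoc, h4, mul_one]
  exact h5

end Counting

/-! ### The weak* topology on bounded sets -/

namespace EllInf

theorem continuous_eval {Γ : Type*} (γ : Γ) : Continuous fun v : EllInf Γ => v.1 γ := by
  classical
  have hh : Memℓp (Pi.single γ (1 : ℝ) : Γ → ℝ) 1 := by
    refine (memℓp_gen_iff (by simp)).2 (summable_of_ne_finset_zero (s := {γ}) fun δ hδ => ?_)
    rw [Pi.single_eq_of_ne (by simpa using hδ)]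
    simp
  have hd : Continuous (fun (v : EllInf Γ) (h : {h : Γ → ℝ // Memℓp h 1}) =>
      ∑' δ, h.1 δ * v.1 δ) := continuous_induced_dom
  refine ((continuous_apply (⟨_, hh⟩ : {h : Γ → ℝ // Memℓp h 1})).comp hd).congr fun v => ?_
  change ∑' δ, (Pi.single γ (1 : ℝ) : Γ → ℝ) δ * v.1 δ = v.1 γ
  rw [tsum_eq_single γ fun δ hδ => by rw [Pi.single_eq_of_ne hδ, zero_mul], Pi.single_eq_same,
    one_mul]

theorem continuous_val {Γ : Type*} : Continuous fun v : EllInf Γ => v.1 :=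
  continuous_pi continuous_eval

instance instT2Space (Γ : Type*) : T2Space (EllInf Γ) :=
  T2Space.of_injective_continuous Subtype.val_injective continuous_val

theorem memℓp_of_abs_le {Γ : Type*} {C : ℝ} {v : Γ → ℝ} (hv : ∀ γ, |v γ| ≤ C) : Memℓp v ∞ := by
  refine memℓp_infty ⟨C, ?_⟩
  rintro _ ⟨γ, rfl⟩
  exact hv γ

/-- A bounded function, as an element of `ℓ^∞`. -/
def ofBounded {Γ : Type*} (C : ℝ) (v : {v : Γ → ℝ // ∀ γ, |v γ| ≤ C}) : EllInf Γ :=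
  ⟨v.1, memℓp_of_abs_le v.2⟩

/-- On bounded sets pointwise convergence implies weak* convergence: the series are dominated by
`|h| * C`. Compactness then follows from Tychonoff's theorem. -/
theorem continuous_ofBounded {Γ : Type*} (C : ℝ) : Continuous (ofBounded (Γ := Γ) C) := by
  refine continuous_induced_rng.2 (continuous_pi fun h => ?_)
  have hs : Summable fun γ => |h.1 γ| * C := by
    have := (memℓp_gen_iff (by simp)).1 h.2
    simp only [ENNReal.toReal_one, Real.rpow_one, Real.norm_eq_abs] at this
    exact this.mul_right C
  refine continuous_tsum (fun γ => ?_) hs fun γ v => ?_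
  · exact continuous_const.mul ((continuous_apply γ).comp continuous_subtype_val)
  · rw [Real.norm_eq_abs, abs_mul]
    exact mul_le_mul_of_nonneg_left (v.2 γ) (abs_nonneg _)

theorem isCompact_setOf_abs_le {Γ : Type*} (C : ℝ) :
    IsCompact {v : EllInf Γ | ∀ γ, |v.1 γ| ≤ C} := by
  have h1 : IsCompact {v : Γ → ℝ | ∀ γ, |v γ| ≤ C} := by
    have := isCompact_univ_pi fun _ : Γ => isCompact_Icc (a := -C) (b := C)
    convert this using 1
    ext v
    simp only [Set.mem_ofPred_eq, Set.mem_univ_pi, Set.mem_Icc, abs_le]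
  have : CompactSpace {v : Γ → ℝ // ∀ γ, |v γ| ≤ C} := isCompact_iff_compactSpace.1 h1
  convert isCompact_range (continuous_ofBounded (Γ := Γ) C) using 1
  ext v
  exact ⟨fun hv => ⟨⟨v.1, hv⟩, rfl⟩, fun ⟨w, hw⟩ => hw ▸ w.2⟩

theorem abs_le_of_mem_closure {Γ : Type*} {C : ℝ} {Y : Set (EllInf Γ)}
    (hY : ∀ v ∈ Y, ∀ γ, |v.1 γ| ≤ C) {v : EllInf Γ} (hv : v ∈ closure Y) (γ : Γ) :
    |v.1 γ| ≤ C :=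
  closure_minimal (t := {v : EllInf Γ | ∀ γ, |v.1 γ| ≤ C}) hY
    (isCompact_setOf_abs_le C).isClosed hv γ

theorem isCompact_closure_of_abs_le {Γ : Type*} {C : ℝ} {Y : Set (EllInf Γ)}
    (hY : ∀ v ∈ Y, ∀ γ, |v.1 γ| ≤ C) : IsCompact (closure Y) :=
  (isCompact_setOf_abs_le C).of_isClosed_subset isClosed_closure
    fun _ hv => abs_le_of_mem_closure hY hv

end EllInf

theorem exists_finset_of_mem_uniformity_pi {Γ : Type*} {V : Set ((Γ → ℝ) × (Γ → ℝ))}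
    (hV : V ∈ uniformity (Γ → ℝ)) : ∃ (K : Finset Γ) (ε : ℝ), 0 < ε ∧
      ∀ x y : Γ → ℝ, (∀ k ∈ K, |y k - x k| < ε) → (x, y) ∈ V := by
  classical
  rw [Pi.uniformity] at hV
  obtain ⟨I, hI, W, hW, rfl⟩ := mem_iInf.1 hV
  have hex : ∀ i : I, ∃ ε > 0, ∀ x y : Γ → ℝ, |y i - x i| < ε → (x, y) ∈ W i := by
    intro i
    obtain ⟨t, ht, htW⟩ := mem_comap.1 (hW i)
    obtain ⟨ε, hε, h⟩ := Metric.mem_uniformity_dist.1 ht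
    exact ⟨ε, hε, fun x y hxy => htW (h (by rwa [dist_comm, Real.dist_eq]))⟩
  choose ε hε h using hex
  have := hI.fintype
  obtain ⟨η, hη, hηε⟩ : ∃ η : ℝ, 0 < η ∧ ∀ i, η ≤ ε i := by
    rcases isEmpty_or_nonempty I with hE | hN
    · exact ⟨1, one_pos, fun i => (hE.false i).elim⟩
    · obtain ⟨i₀, hi₀⟩ := Finite.exists_min ε
      exact ⟨ε i₀, hε i₀, hi₀⟩
  refine ⟨I.toFinset, η, hη, fun x y hxy => Set.mem_iInter.2 fun i => h i x y ?_⟩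
  exact (hxy i (Set.mem_toFinset.2 i.2)).trans_le (hηε i)

/-- A Lebesgue number for an open cover of a compact set of bounded functions. -/
theorem EllInf.exists_lebesgue {Γ : Type*} {Y : Set (EllInf Γ)} (hY : IsCompact Y)
    {U : Set (Set Y)} (hU : IsOpenCoverOf U) : ∃ (K : Finset Γ) (ε : ℝ), 0 < ε ∧
      ∀ y : Y, ∃ u ∈ U, ∀ y' : Y, (∀ k ∈ K, |y'.1.1 k - y.1.1 k| < ε) → y' ∈ u := by
  have : CompactSpace Y := isCompact_iff_compactSpace.1 hY
  let ι : Y → Γ → ℝ := fun y => y.1.1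
  have hc : Continuous ι := continuous_val.comp continuous_subtype_val
  -- A continuous injection of a compact space into a Hausdorff space is an embedding, so the weak*
  -- topology on `Y` is that of pointwise convergence.
  have hemb : IsClosedEmbedding ι :=
    hc.isClosedEmbedding fun a b h => Subtype.ext (Subtype.ext h)
  have hO : ∀ u : U, ∃ O : Set (Γ → ℝ), IsOpen O ∧ ι ⁻¹' O = u := fun u =>
    hemb.isInducing.isOpen_iff.1 (hU.1 u u.2)
  choose O hOo hOu using hO
  obtain ⟨V, hV, hVU⟩ := lebesgue_number_lemma (isCompact_range hc) hOo (by
    rintro _ ⟨y, rfl⟩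
    obtain ⟨u, hu, hyu⟩ : y ∈ ⋃₀ U := hU.2 ▸ Set.mem_univ _
    refine Set.mem_iUnion.2 ⟨⟨u, hu⟩, ?_⟩
    have : y ∈ ι ⁻¹' O ⟨u, hu⟩ := by rw [hOu]; exact hyu
    exact this)
  obtain ⟨K, ε, hε, hK⟩ := exists_finset_of_mem_uniformity_pi hV
  refine ⟨K, ε, hε, fun y => ?_⟩
  obtain ⟨u, hu⟩ := hVU (ι y) ⟨y, rfl⟩
  refine ⟨u, u.2, fun y' hy' => ?_⟩
  rw [← hOu u]
  exact hu (hK _ _ hy')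

/-! ### The spaces `X_f`, `Y_f`, `Z_f` and their closures -/

section Spaces

/-- The `ℓ¹` norm of `f`. -/
def ellOneNorm {Γ : Type*} (f : MonoidAlgebra ℤ Γ) : ℝ := ∑ δ ∈ f.coeff.support, |(f.coeff δ : ℝ)|

theorem ellOneNorm_nonneg {Γ : Type*} (f : MonoidAlgebra ℤ Γ) : 0 ≤ ellOneNorm f :=
  Finset.sum_nonneg fun _ _ => abs_nonneg _

variable {Γ : Type*} [Group Γ] (f : MonoidAlgebra ℤ Γ)

theorem Xf.smul_apply (γ : Γ) (x : Xf f) (δ : Γ) : (γ • x).1 δ = x.1 (γ⁻¹ * δ) := rfl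

theorem YfBar.smul_apply (γ : Γ) (y : YfBar f) (δ : Γ) : (γ • y).1.1 δ = y.1.1 (γ⁻¹ * δ) := rfl

theorem ZfBar.smul_apply (γ : Γ) (z : ZfBar f) (δ : Γ) : (γ • z).1.1 δ = z.1.1 (γ⁻¹ * δ) := rfl

theorem abs_rightConv_le {C : ℝ} (v : Γ → ℝ) (γ : Γ)
    (hv : ∀ δ ∈ f.coeff.support, |v (γ * δ)| ≤ C) : |rightConv f v γ| ≤ ellOneNorm f * C := by
  rw [ellOneNorm, Finset.sum_mul]
  refine (Finset.abs_sum_le_sum_abs _ _).trans (Finset.sum_le_sum fun δ hδ => ?_)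
  rw [zsmul_eq_mul, abs_mul]
  exact mul_le_mul_of_nonneg_left (hv δ hδ) (abs_nonneg _)

theorem continuous_rightConv {A : Type*} [AddCommGroup A] [TopologicalSpace A]
    [IsTopologicalAddGroup A] : Continuous (rightConv f : (Γ → A) → Γ → A) :=
  continuous_pi fun γ => continuous_finsetSum _ fun δ _ =>
    (continuous_apply (γ * δ)).zsmul _

theorem rightConv_map {A B : Type*} [AddCommGroup A] [AddCommGroup B] (g : A →+ B) (x : Γ → A)
    (γ : Γ) : rightConv f (fun δ => g (x δ)) γ = g (rightConv f x γ) := by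
  simp [rightConv, map_sum, map_zsmul]

theorem rightConv_coe (v : Γ → ℝ) (γ : Γ) :
    rightConv f (fun δ => (v δ : UnitAddCircle)) γ = ((rightConv f v γ : ℝ) : UnitAddCircle) :=
  rightConv_map f (QuotientAddGroup.mk' (AddSubgroup.zmultiples (1 : ℝ))) v γ

theorem rightConv_intCast (m : Γ → ℤ) (γ : Γ) :
    rightConv f (fun δ => (m δ : ℝ)) γ = (rightConv f m γ : ℤ) :=
  rightConv_map f (Int.castAddHom ℝ) m γ

theorem rightConv_congr {A : Type*} [AddCommGroup A] {x y : Γ → A} {γ : Γ}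
    (h : ∀ δ ∈ f.coeff.support, x (γ * δ) = y (γ * δ)) : rightConv f x γ = rightConv f y γ :=
  Finset.sum_congr rfl fun δ hδ => by rw [h δ hδ]

theorem rightConv_add {A : Type*} [AddCommGroup A] (x y : Γ → A) :
    rightConv f (x + y) = rightConv f x + rightConv f y := by
  funext γ
  simp [rightConv, Finset.sum_add_distrib]

theorem rightConv_sub {A : Type*} [AddCommGroup A] (x y : Γ → A) :
    rightConv f (x - y) = rightConv f x - rightConv f y := by
  funext γ
  simp [rightConv, smul_sub, Finset.sum_sub_distrib]

theorem coe_unitAddCircle_eq_zero_iff {x : ℝ} : (x : UnitAddCircle) = 0 ↔ ∃ n : ℤ, (n : ℝ) = x := by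
  rw [AddCircle.coe_eq_zero_iff]
  simp

/-- The image in `𝕋^Γ` of a real function lies in `X_f` if and only if its image under `ρ^f` is
integer valued. -/
theorem coe_mem_Xf_iff (v : Γ → ℝ) :
    (fun γ => (v γ : UnitAddCircle)) ∈ Xf f ↔ ∀ γ, ∃ n : ℤ, (n : ℝ) = rightConv f v γ := by
  change rightConv f _ = 0 ↔ _
  rw [funext_iff]
  refine forall_congr' fun γ => ?_
  rw [rightConv_coe, Pi.zero_apply, coe_unitAddCircle_eq_zero_iff]

theorem isClosed_Xf : IsClosed (Xf f) :=
  isClosed_singleton.preimage (continuous_rightConv f)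

theorem abs_le_one_of_mem_Yf {v : EllInf Γ} (hv : v ∈ Yf f) (γ : Γ) : |v.1 γ| ≤ 1 :=
  abs_le.2 ⟨by linarith [(hv.2 γ).1], (hv.2 γ).2.le⟩

theorem mem_Icc_of_mem_YfBar {v : EllInf Γ} (hv : v ∈ YfBar f) (γ : Γ) :
    v.1 γ ∈ Set.Icc (0 : ℝ) 1 :=
  closure_minimal (t := {v : EllInf Γ | v.1 γ ∈ Set.Icc (0 : ℝ) 1})
    (fun _ hw => Set.Ico_subset_Icc_self (hw.2 γ))
    (isClosed_Icc.preimage (EllInf.continuous_eval γ)) hv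

theorem isCompact_YfBar : IsCompact (YfBar f) :=
  EllInf.isCompact_closure_of_abs_le fun _ hv => abs_le_one_of_mem_Yf f hv

theorem abs_le_of_mem_Zf {v : EllInf Γ} (hv : v ∈ Zf f) (γ : Γ) : |v.1 γ| ≤ ellOneNorm f := by
  obtain ⟨y, hy, rfl⟩ := hv
  rw [← mul_one (ellOneNorm f)]
  exact abs_rightConv_le f y.1 γ fun δ _ => abs_le_one_of_mem_Yf f hy _

theorem isCompact_ZfBar : IsCompact (ZfBar f) :=
  EllInf.isCompact_closure_of_abs_le fun _ hv => abs_le_of_mem_Zf f hv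

/-- Evaluation at `γ` is weak* continuous and `ℤ` is closed in `ℝ`, so integrality passes to the
closure. -/
theorem exists_int_of_mem_ZfBar {v : EllInf Γ} (hv : v ∈ ZfBar f) (γ : Γ) :
    ∃ n : ℤ, (n : ℝ) = v.1 γ := by
  refine closure_minimal (t := {v : EllInf Γ | v.1 γ ∈ Set.range ((↑) : ℤ → ℝ)}) ?_
    (Int.isClosedEmbedding_coe_real.isClosed_range.preimage (EllInf.continuous_eval γ)) hv
  rintro _ ⟨y, hy, rfl⟩
  exact (coe_mem_Xf_iff f y.1).1 hy.1 γ

theorem ZfBar.eq_of_abs_sub_lt_one (z z' : ZfBar f) (γ : Γ) (h : |z'.1.1 γ - z.1.1 γ| < 1) :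
    z'.1.1 γ = z.1.1 γ := by
  obtain ⟨n, hn⟩ := exists_int_of_mem_ZfBar f z.2 γ
  obtain ⟨n', hn'⟩ := exists_int_of_mem_ZfBar f z'.2 γ
  rw [← hn, ← hn'] at h ⊢
  have hnn : |n' - n| < 1 := by exact_mod_cast h
  rw [Int.abs_lt_one_iff, sub_eq_zero] at hnn
  rw [hnn]

/-- A point of the closure of `Z_f` agrees on a finite set with a point of `Z_f`. -/
theorem ZfBar.exists_Yf_eqOn (z : ZfBar f) (A : Finset Γ) :
    ∃ y ∈ Yf f, ∀ γ ∈ A, rightConv f y.1 γ = z.1.1 γ := by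
  have hopen : IsOpen {v : EllInf Γ | ∀ γ ∈ A, |v.1 γ - z.1.1 γ| < 1} := by
    have : {v : EllInf Γ | ∀ γ ∈ A, |v.1 γ - z.1.1 γ| < 1} =
        ⋂ γ ∈ A, {v : EllInf Γ | |v.1 γ - z.1.1 γ| < 1} := by
      ext v
      simp
    rw [this]
    exact isOpen_biInter_finset fun γ _ =>
      isOpen_lt ((EllInf.continuous_eval γ).sub continuous_const).abs continuous_const
  obtain ⟨v, hv, hvZ⟩ := mem_closure_iff.1 z.2 _ hopen (fun γ _ => by simp)
  have hvb : v ∈ ZfBar f := subset_closure hvZ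
  obtain ⟨y, hy, rfl⟩ := hvZ
  exact ⟨y, hy, fun γ hγ => ZfBar.eq_of_abs_sub_lt_one f z ⟨_, hvb⟩ γ (hv γ hγ)⟩

theorem etaMap_mem_Xf_of_mem_YfBar {v : EllInf Γ} (hv : v ∈ YfBar f) : etaMap v ∈ Xf f := by
  have hc : Continuous (etaMap : EllInf Γ → Γ → UnitAddCircle) :=
    continuous_pi fun γ => (AddCircle.continuous_mk' 1).comp (EllInf.continuous_eval γ)
  exact closure_minimal (t := etaMap ⁻¹' Xf f) (fun w hw => hw.1)
    ((isClosed_Xf f).preimage hc) hv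

/-- Reduction mod 1 is a factor map; fractional parts lift every point of `X_f` to `Y_f` itself. -/
theorem topEntropy_Xf_le_topEntropy_YfBar : topEntropy Γ (Xf f) ≤ topEntropy Γ (YfBar f) := by
  refine topEntropy_le_of_factor
    (fun y : YfBar f => (⟨etaMap y.1, etaMap_mem_Xf_of_mem_YfBar f y.2⟩ : Xf f)) ?_ ?_
    fun γ y => rfl
  · exact Continuous.subtype_mk (continuous_pi fun γ => (AddCircle.continuous_mk' 1).comp
      ((EllInf.continuous_eval γ).comp continuous_subtype_val)) _
  · rintro ⟨x, hx⟩
    have hex : ∀ γ, ∃ t ∈ Set.Ico (0 : ℝ) 1, (t : UnitAddCircle) = x γ := by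
      intro γ
      obtain ⟨t, hxt⟩ := QuotientAddGroup.mk_surjective (x γ)
      refine ⟨Int.fract t, ⟨Int.fract_nonneg t, Int.fract_lt_one t⟩, ?_⟩
      rw [← hxt, Int.fract, ← sub_eq_zero, ← AddCircle.coe_sub, coe_unitAddCircle_eq_zero_iff]
      exact ⟨-⌊t⌋, by push_cast; ring⟩
    choose t ht htx using hex
    have htb : Memℓp t ∞ := EllInf.memℓp_of_abs_le (C := 1) fun γ =>
      abs_le.2 ⟨by linarith [(ht γ).1], (ht γ).2.le⟩
    have heta : etaMap (⟨t, htb⟩ : EllInf Γ) = x := funext htx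
    refine ⟨⟨⟨t, htb⟩, subset_closure ⟨?_, ht⟩⟩, Subtype.ext heta⟩
    change etaMap (⟨t, htb⟩ : EllInf Γ) ∈ Xf f
    rwa [heta]

theorem rhoBar_mem_ZfBar {v : EllInf Γ} (hv : v ∈ YfBar f) : rhoBar f v ∈ ZfBar f := by
  have hb : ∀ v : YfBar f, ∀ γ, |rightConv f v.1.1 γ| ≤ ellOneNorm f := by
    intro v γ
    rw [← mul_one (ellOneNorm f)]
    exact abs_rightConv_le f _ γ fun δ _ =>
      EllInf.abs_le_of_mem_closure (fun _ hw => abs_le_one_of_mem_Yf f hw) v.2 _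
  have hc : ContinuousOn (rhoBar f) (closure (Yf f)) := by
    rw [continuousOn_iff_continuous_domRestrict]
    exact (EllInf.continuous_ofBounded (ellOneNorm f)).comp
      (Continuous.subtype_mk ((continuous_rightConv f).comp
        (EllInf.continuous_val.comp continuous_subtype_val)) hb)
  exact hc.image_closure ⟨v, hv, rfl⟩

end Spaces

/-! ### Finite-dimensional kernels of `ρ^f` -/

section Kernels

theorem extend_val_of_mem {Γ : Type*} {A : Finset Γ} (v : A → ℝ) {γ : Γ} (h : γ ∈ A) :
    Function.extend Subtype.val v 0 γ = v ⟨γ, h⟩ :=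
  Subtype.val_injective.extend_apply v 0 ⟨γ, h⟩

theorem extend_val_of_notMem {Γ : Type*} {A : Finset Γ} (v : A → ℝ) {γ : Γ} (h : γ ∉ A) :
    Function.extend Subtype.val v 0 γ = 0 :=
  Function.extend_apply' v (0 : Γ → ℝ) γ fun ⟨a, ha⟩ => h (ha ▸ a.2)

variable {Γ : Type*} [Group Γ] (f : MonoidAlgebra ℤ Γ)

/-- `ρ^f` as a linear map on `ℝ^Γ`. -/
def rightConvLinear : (Γ → ℝ) →ₗ[ℝ] (Γ → ℝ) where
  toFun := rightConv f
  map_add' := rightConv_add f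
  map_smul' c x := by
    funext γ
    simp only [rightConv, Pi.smul_apply, smul_eq_mul, zsmul_eq_mul, RingHom.id_apply,
      Finset.mul_sum]
    exact Finset.sum_congr rfl fun δ _ => by ring

/-- The functions on `A` whose extension by zero is mapped by `ρ^f` to a function vanishing
on `E`. -/
def kerOn (A : Finset Γ) (E : Set Γ) : Submodule ℝ (A → ℝ) :=
  LinearMap.ker (LinearMap.funLeft ℝ ℝ (Subtype.val : E → Γ) ∘ₗ rightConvLinear f ∘ₗ
    Function.ExtendByZero.linearMap ℝ (Subtype.val : A → Γ))

variable {f}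

theorem mem_kerOn {A : Finset Γ} {E : Set Γ} {v : A → ℝ} :
    v ∈ kerOn f A E ↔ ∀ γ ∈ E, rightConv f (Function.extend Subtype.val v 0) γ = 0 := by
  rw [kerOn, LinearMap.mem_ker, funext_iff, Subtype.forall]
  rfl

/-- On `E`, `ρ^f` reads only coordinates in `A`, so replacing `u` by zero outside `A` changes
nothing there. -/
theorem restrict_mem_kerOn {A : Finset Γ} {E : Set Γ}
    (hA : ∀ γ ∈ E, ∀ δ ∈ f.coeff.support, γ * δ ∈ A) {u : Γ → ℝ}
    (hu : ∀ γ ∈ E, rightConv f u γ = 0) : (fun a : A => u a) ∈ kerOn f A E := by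
  refine mem_kerOn.2 fun γ hγ => ?_
  rw [← hu γ hγ]
  exact rightConv_congr f fun δ hδ => extend_val_of_mem _ (hA γ hγ δ hδ)

-- Rank–nullity for restriction to `A \ I`. A function in the kernel of that restriction is
-- supported in `I`; off `E`, `ρ^f` reads no coordinate in `I`, so its image vanishes everywhere.
open scoped Classical in
theorem finrank_kerOn_le {A I : Finset Γ} {E : Set Γ}
    (hI : ∀ γ, ∀ δ ∈ f.coeff.support, γ * δ ∈ I → γ ∈ E) :
    Module.finrank ℝ (kerOn f A E) ≤
      Module.finrank ℝ (kerOn f I Set.univ) + (A \ I).card := by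
  let ext : kerOn f A E →ₗ[ℝ] (Γ → ℝ) :=
    Function.ExtendByZero.linearMap ℝ (Subtype.val : A → Γ) ∘ₗ (kerOn f A E).subtype
  have hext : ∀ v : kerOn f A E, ext v = Function.extend Subtype.val v.1 0 := fun v => rfl
  let φ : kerOn f A E →ₗ[ℝ] ((A \ I : Finset Γ) → ℝ) :=
    LinearMap.funLeft ℝ ℝ (Subtype.val : (A \ I : Finset Γ) → Γ) ∘ₗ ext
  let ψ : LinearMap.ker φ →ₗ[ℝ] (I → ℝ) :=
    LinearMap.funLeft ℝ ℝ (Subtype.val : I → Γ) ∘ₗ ext ∘ₗ (LinearMap.ker φ).subtype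
  have hvanish : ∀ v : LinearMap.ker φ, ∀ γ ∉ I, ext v.1 γ = 0 := by
    intro v γ hγ
    by_cases hA : γ ∈ A
    · exact congrFun (LinearMap.mem_ker.1 v.2) ⟨γ, Finset.mem_sdiff.2 ⟨hA, hγ⟩⟩
    · exact extend_val_of_notMem _ hA
  have hψext : ∀ v : LinearMap.ker φ, Function.extend Subtype.val (ψ v) 0 = ext v.1 := by
    intro v
    funext γ
    by_cases hγ : γ ∈ I
    · exact extend_val_of_mem _ hγ
    · rw [extend_val_of_notMem _ hγ, hvanish v γ hγ]
  have hψmem : ∀ v, ψ v ∈ kerOn f I Set.univ := by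
    intro v
    refine mem_kerOn.2 fun γ _ => ?_
    rw [hψext]
    by_cases hγ : γ ∈ E
    · exact mem_kerOn.1 v.1.2 γ hγ
    · refine Finset.sum_eq_zero fun δ hδ => ?_
      rw [hvanish v _ fun h => hγ (hI γ δ hδ h), smul_zero]
  have hinj : Function.Injective (ψ.codRestrict _ hψmem) := by
    intro v w hvw
    have h1 : ψ v = ψ w := congrArg Subtype.val hvw
    have h2 : ext v.1 = ext w.1 := by rw [← hψext, ← hψext, h1]
    refine Subtype.ext (Subtype.ext (funext fun a => ?_))
    have h3 := congrFun h2 a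
    rwa [hext, hext, extend_val_of_mem _ a.2, extend_val_of_mem _ a.2] at h3
  have h1 := LinearMap.finrank_range_add_finrank_ker φ
  have h2 : Module.finrank ℝ (LinearMap.range φ) ≤ (A \ I).card := by
    have := Submodule.finrank_le (LinearMap.range φ)
    simpa using this
  have h3 := LinearMap.finrank_le_finrank_of_injective hinj
  omega

open scoped Classical in
/-- The inverse of the set of those `g ∈ F` with `S g ⊆ F`. -/
def invInterior (S F : Finset Γ) : Finset Γ := (F.filter fun g => ∀ s ∈ S, s * g ∈ F)⁻¹

open scoped Classical in
theorem mem_invInterior {S F : Finset Γ} {γ : Γ} :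
    γ ∈ invInterior S F ↔ γ⁻¹ ∈ F ∧ ∀ s ∈ S, s * γ⁻¹ ∈ F := by
  rw [invInterior, Finset.mem_inv', Finset.mem_filter]

-- For `γ` in the difference, either `γ⁻¹` lies in some `k⁻¹ • F` but not in `F`, or `γ⁻¹ ∈ F` and
-- some `s * γ⁻¹` leaves `F`. The inverses appear because the shift by `g` reads coordinate `g⁻¹ *
-- k`.
open scoped Classical in
theorem card_sdiff_invInterior_le {S K F : Finset Γ} {ε : ℝ}
    (hF : F ∈ leftInvariantSets (K⁻¹ ∪ S) ε) :
    (((F⁻¹ * K) \ invInterior S F).card : ℝ) ≤ (K.card + S.card) * (ε * F.card) := by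
  have hsub : (F⁻¹ * K) \ invInterior S F ⊆
      (K.biUnion fun k => ((k⁻¹ • F) ∆ F).image fun x => x⁻¹) ∪
        S.biUnion fun s => ((s • F) ∆ F).image fun x => (s⁻¹ * x)⁻¹ := by
    intro γ hγ
    obtain ⟨h1, h2⟩ := Finset.mem_sdiff.1 hγ
    obtain ⟨g', hg', k, hk, rfl⟩ := Finset.mem_mul.1 h1
    rw [Finset.mem_inv'] at hg'
    rw [mem_invInterior] at h2
    by_cases hF' : (g' * k)⁻¹ ∈ F
    · push Not at h2
      obtain ⟨s, hs, hsF⟩ := h2 hF'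
      refine Finset.mem_union_right _ (Finset.mem_biUnion.2 ⟨s, hs, Finset.mem_image.2
        ⟨s * (g' * k)⁻¹, Finset.mem_symmDiff.2 (Or.inl ⟨?_, hsF⟩), ?_⟩⟩)
      · exact Finset.smul_mem_smul_finset hF'
      · rw [inv_mul_cancel_left, inv_inv]
    · refine Finset.mem_union_left _ (Finset.mem_biUnion.2 ⟨k, hk, Finset.mem_image.2
        ⟨(g' * k)⁻¹, Finset.mem_symmDiff.2 (Or.inl ⟨?_, hF'⟩), inv_inv _⟩⟩)
      rw [mul_inv_rev]
      exact Finset.smul_mem_smul_finset hg'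
  have hK : ∀ k ∈ K, (((((k⁻¹ • F) ∆ F).image fun x => x⁻¹).card : ℕ) : ℝ) ≤ ε * F.card := by
    intro k hk
    refine le_trans ?_ (hF.2 k⁻¹ (Finset.mem_union_left _ (Finset.inv_mem_inv hk)))
    exact_mod_cast Finset.card_image_le
  have hS : ∀ s ∈ S, (((((s • F) ∆ F).image fun x => (s⁻¹ * x)⁻¹).card : ℕ) : ℝ) ≤
      ε * F.card := by
    intro s hs
    refine le_trans ?_ (hF.2 s (Finset.mem_union_right _ hs))
    exact_mod_cast Finset.card_image_le
  have hle := (Finset.card_le_card hsub).trans ((Finset.card_union_le _ _).trans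
    (add_le_add Finset.card_biUnion_le Finset.card_biUnion_le))
  calc (((F⁻¹ * K) \ invInterior S F).card : ℝ)
      ≤ ∑ k ∈ K, (((((k⁻¹ • F) ∆ F).image fun x => x⁻¹).card : ℕ) : ℝ) +
        ∑ s ∈ S, (((((s • F) ∆ F).image fun x => (s⁻¹ * x)⁻¹).card : ℕ) : ℝ) := by
        exact_mod_cast hle
    _ ≤ ∑ _k ∈ K, ε * F.card + ∑ _s ∈ S, ε * F.card :=
        add_le_add (Finset.sum_le_sum hK) (Finset.sum_le_sum hS)
    _ = _ := by simp only [Finset.sum_const, nsmul_eq_mul]; ring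

/-! ### Covers of `X_f` by sets of small diameter -/

variable (f)

/-- The open subsets of `X_f` whose coordinates in `K` vary by less than `ε`. -/
def closeCover (K : Finset Γ) (ε : ℝ) : Set (Set (Xf f)) :=
  {u | IsOpen u ∧ ∀ x ∈ u, ∀ x' ∈ u, ∀ k ∈ K, ‖x'.1 k - x.1 k‖ < ε}

theorem isOpenCoverOf_closeCover (K : Finset Γ) {ε : ℝ} (hε : 0 < ε) :
    IsOpenCoverOf (closeCover f K ε) := by
  refine ⟨fun u hu => hu.1, Set.eq_univ_of_forall fun x => ?_⟩
  refine ⟨⋂ k ∈ K, {x' : Xf f | ‖x'.1 k - x.1 k‖ < ε / 2},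
    ⟨isOpen_biInter_finset fun k _ => ?_, fun y hy y' hy' k hk => ?_⟩, ?_⟩
  · exact isOpen_lt ((((continuous_apply k).comp continuous_subtype_val).sub
      continuous_const).norm) continuous_const
  · have h1 : ‖y.1 k - x.1 k‖ < ε / 2 := Set.mem_iInter₂.1 hy k hk
    have h2 : ‖y'.1 k - x.1 k‖ < ε / 2 := Set.mem_iInter₂.1 hy' k hk
    calc ‖y'.1 k - y.1 k‖ = ‖(y'.1 k - x.1 k) - (y.1 k - x.1 k)‖ := by congr 1; abel
      _ ≤ ‖y'.1 k - x.1 k‖ + ‖y.1 k - x.1 k‖ := norm_sub_le _ _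
      _ < ε := by linarith
  · refine Set.mem_iInter₂.2 fun k _ => ?_
    change ‖x.1 k - x.1 k‖ < ε / 2
    rw [sub_self, norm_zero]
    exact half_pos hε

variable {f}

theorem norm_sub_lt_of_mem_coverJoin_closeCover {K F : Finset Γ} {ε : ℝ} {v : Set (Xf f)}
    (hv : v ∈ coverJoin (closeCover f K ε) F) {x x' : Xf f} (hx : x ∈ v) (hx' : x' ∈ v)
    {g k : Γ} (hg : g ∈ F) (hk : k ∈ K) : ‖x'.1 (g⁻¹ * k) - x.1 (g⁻¹ * k)‖ < ε := by
  obtain ⟨φ, hφ, rfl⟩ := hv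
  exact (hφ g hg).2 _ (Set.mem_iInter₂.1 hx g hg) _ (Set.mem_iInter₂.1 hx' g hg) k hk

/-- Elements of the kernel reduce mod 1 to points of `X_f`. In the ball of radius `1 / 4`
coordinates differ by at most `1 / 2`, where the circle norm is the absolute value, so the cover of
`X_f` covers this ball by sets of diameter at most `ε`. -/
theorem pow_finrank_kerOn_le {I F : Finset Γ} (hI : ∀ γ ∈ I, γ⁻¹ ∈ F) {ε : ℝ} (hε : 0 ≤ ε)
    (V : Finset (Set (Xf f)))
    (hV : (V : Set (Set (Xf f))) ⊆ coverJoin (closeCover f {1} ε) F)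
    (hcov : ⋃₀ (V : Set (Set (Xf f))) = Set.univ) :
    (1 / 4 : ℝ) ^ Module.finrank ℝ (kerOn f I Set.univ) ≤
      V.card * ε ^ Module.finrank ℝ (kerOn f I Set.univ) := by
  have hX : ∀ w : kerOn f I Set.univ,
      (fun γ => ((Function.extend Subtype.val w.1 0 γ : ℝ) : UnitAddCircle)) ∈ Xf f := by
    intro w
    refine (coe_mem_Xf_iff f _).2 fun γ => ⟨0, ?_⟩
    rw [mem_kerOn.1 w.2 γ (Set.mem_univ _), Int.cast_zero]
  let π : kerOn f I Set.univ → Xf f := fun w => ⟨_, hX w⟩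
  refine pow_le_card_mul_pow_of_closedBall_subset (by norm_num) hε V
    (fun v => {w | ‖w‖ ≤ 1 / 4 ∧ π w ∈ v}) ?_ ?_
  · intro w hw
    obtain ⟨v, hv, hwv⟩ : π w ∈ ⋃₀ (V : Set (Set (Xf f))) := hcov ▸ Set.mem_univ _
    exact Set.mem_iUnion₂.2 ⟨v, hv, by simpa using hw, hwv⟩
  · rintro v hv w ⟨hw, hwv⟩ w' ⟨hw', hwv'⟩
    refine (dist_pi_le_iff hε).2 fun a => ?_
    have h1 := norm_sub_lt_of_mem_coverJoin_closeCover (hV hv) hwv' hwv (hI a a.2)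
      (Finset.mem_singleton_self 1)
    rw [inv_inv, mul_one] at h1
    have h2 : (π w).1 a - (π w').1 a = ((w.1 a - w'.1 a : ℝ) : UnitAddCircle) := by
      change ((Function.extend Subtype.val w.1 0 a.1 : ℝ) : UnitAddCircle) -
        ((Function.extend Subtype.val w'.1 0 a.1 : ℝ) : UnitAddCircle) = _
      rw [extend_val_of_mem _ a.2, extend_val_of_mem _ a.2, AddCircle.coe_sub]
    have h3 : |w.1 a| ≤ 1 / 4 := (norm_le_pi_norm w.1 a).trans hw
    have h4 : |w'.1 a| ≤ 1 / 4 := (norm_le_pi_norm w'.1 a).trans hw'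
    rw [h2, (AddCircle.norm_coe_eq_abs_iff 1 one_ne_zero).2 ?_] at h1
    · exact h1.le
    · rw [abs_le] at h3 h4
      rw [abs_one, abs_le]
      constructor <;> linarith

open scoped Classical in
/-- If `λ_f` has finite entropy, then the kernel of `ρ^f` on large almost invariant sets is of
small dimension relative to the size of the set. -/
theorem eventually_finrank_kerOn_le (hf : topEntropy Γ (Xf f) < ⊤) (K : Finset Γ) {c : ℝ}
    (hc : 0 < c) : ∀ᶠ F in leftFolnerFilter Γ,
      (Module.finrank ℝ (kerOn f (F⁻¹ * K) (F⁻¹ : Finset Γ)) : ℝ) ≤ c * F.card := by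
  obtain ⟨M, hM, -⟩ := EReal.lt_iff_exists_real_btwn.1 hf
  -- With `ε = exp (-L) / 4` the volume bound reads `exp (d * L) ≤ |V| ≤ exp (M * |F|)`, and this
  -- `L` makes `d ≤ (c / 2) * |F|`. The other half of `c` pays for the boundary, through `η`.
  let L : ℝ := 2 * |M| / c + 1
  have hL : 0 < L := by positivity
  let ε : ℝ := Real.exp (-L) / 4
  have hε : 0 < ε := by positivity
  let S := f.coeff.support
  let η : ℝ := c / 2 / (K.card + S.card + 1)
  have hη : 0 < η := by positivity
  have hlim : limsup (fun F : Finset Γ =>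
      ENNReal.log ((minCoverCard (coverJoin (closeCover f {1} ε) F) : ℕ∞) : ℝ≥0∞) /
        ((F.card : ℝ) : EReal)) (leftFolnerFilter Γ) < M :=
    (le_iSup₂ (f := fun (U : Set (Set (Xf f))) (_ : IsOpenCoverOf U) =>
      limsup (fun F : Finset Γ =>
        ENNReal.log ((minCoverCard (coverJoin U F) : ℕ∞) : ℝ≥0∞) / ((F.card : ℝ) : EReal))
        (leftFolnerFilter Γ)) _ (isOpenCoverOf_closeCover f {1} hε)).trans_lt hM
  filter_upwards [eventually_lt_of_limsup_lt hlim,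
    eventually_leftInvariantSets (K⁻¹ ∪ S) hη] with F hF hinv
  have hFpos : (0 : ℝ) < F.card := by exact_mod_cast hinv.1.card_pos
  set N := minCoverCard (coverJoin (closeCover f {1} ε) F) with hN
  have hlog : ENNReal.log (N : ℝ≥0∞) ≤ ((F.card * M : ℝ) : EReal) := by
    rw [EReal.coe_mul]
    exact (EReal.div_le_iff_le_mul (by exact_mod_cast hFpos) (EReal.coe_ne_top _)).1 hF.le
  have hNtop : N ≠ ⊤ := by
    intro h
    rw [h, ENat.toENNReal_top, ENNReal.log_top, top_le_iff] at hlog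
    exact EReal.coe_ne_top _ hlog
  obtain ⟨V, hV, hcov, hVN⟩ := exists_subcover_card_eq_minCoverCard hNtop
  let I := invInterior S F
  have hpow := pow_finrank_kerOn_le (I := I) (fun γ hγ => (mem_invInterior.1 hγ).1) hε.le V hV hcov
  set d := Module.finrank ℝ (kerOn f I Set.univ) with hd
  have hVpos : (0 : ℝ) < V.card := by
    by_contra h
    have h0 : (V.card : ℝ) = 0 := le_antisymm (not_lt.1 h) (Nat.cast_nonneg _)
    rw [h0, zero_mul] at hpow
    exact absurd hpow (not_le.2 (by positivity))
  have hdL : (d : ℝ) * L ≤ Real.log V.card := by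
    rw [Real.le_log_iff_exp_le hVpos, Real.exp_nat_mul]
    have h1 : ε ^ d = (Real.exp L ^ d)⁻¹ * (1 / 4) ^ d := by
      rw [← inv_pow, ← Real.exp_neg, ← mul_pow]
      congr 1
      simp only [ε]
      ring
    rw [h1, ← mul_assoc] at hpow
    have h2 : 1 ≤ V.card * (Real.exp L ^ d)⁻¹ :=
      le_of_mul_le_mul_right (by rwa [one_mul]) (by positivity : (0 : ℝ) < (1 / 4) ^ d)
    rwa [← div_eq_mul_inv, one_le_div (by positivity)] at h2
  have hVM : Real.log V.card ≤ F.card * M := by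
    rw [hN, hVN, ENat.toENNReal_coe, ← ENNReal.ofReal_natCast,
      ENNReal.log_ofReal_of_pos hVpos] at hlog
    exact_mod_cast hlog
  have hdc : (d : ℝ) ≤ c / 2 * F.card := by
    have h1 : (d : ℝ) * L ≤ c / 2 * F.card * L := by
      refine hdL.trans (hVM.trans ?_)
      have h2 : c / 2 * F.card * L = F.card * |M| + c / 2 * F.card := by
        simp only [L]
        field_simp
      rw [h2]
      have h3 : F.card * M ≤ F.card * |M| := mul_le_mul_of_nonneg_left (le_abs_self M) hFpos.le
      have h4 : 0 ≤ c / 2 * F.card := by positivity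
      linarith
    exact le_of_mul_le_mul_right h1 hL
  have hbd := card_sdiff_invInterior_le hinv
  have hbd' : (K.card + S.card : ℝ) * (η * F.card) ≤ c / 2 * F.card := by
    rw [← mul_assoc]
    refine mul_le_mul_of_nonneg_right ?_ hFpos.le
    simp only [η]
    rw [mul_div_assoc', div_le_iff₀ (by positivity)]
    nlinarith
  have hrank : Module.finrank ℝ (kerOn f (F⁻¹ * K) (F⁻¹ : Finset Γ)) ≤
      d + ((F⁻¹ * K) \ I).card := by
    refine finrank_kerOn_le fun γ δ hδ hγδ => ?_
    -- Here `δ * (γ * δ)⁻¹ = γ⁻¹`; hence the interior is taken with respect to the support of `f`.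
    have := (mem_invInterior.1 hγδ).2 δ hδ
    rw [mul_inv_rev, mul_inv_cancel_left] at this
    exact Finset.mem_coe.2 (Finset.mem_inv'.2 this)
  have hrank' : (Module.finrank ℝ (kerOn f (F⁻¹ * K) (F⁻¹ : Finset Γ)) : ℝ) ≤
      d + ((F⁻¹ * K) \ I).card := by exact_mod_cast hrank
  linarith

end Kernels

/-! ### Comparison of entropies -/

section Comparison

variable {Γ : Type*} [Group Γ] (f : MonoidAlgebra ℤ Γ)

/-- The open subsets of the closure of `Z_f` on which the coordinate at `1` is constant. -/
def stateCover : Set (Set (ZfBar f)) :=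
  {u | IsOpen u ∧ ∀ z ∈ u, ∀ z' ∈ u, z'.1.1 1 = z.1.1 1}

theorem isOpenCoverOf_stateCover : IsOpenCoverOf (stateCover f) := by
  refine ⟨fun u hu => hu.1, Set.eq_univ_of_forall fun z => ?_⟩
  refine ⟨{z' : ZfBar f | |z'.1.1 1 - z.1.1 1| < 1}, ⟨?_, fun y hy y' hy' => ?_⟩, ?_⟩
  · exact isOpen_lt (((EllInf.continuous_eval 1).comp continuous_subtype_val).sub
      continuous_const).abs continuous_const
  · rw [ZfBar.eq_of_abs_sub_lt_one f z y 1 hy, ZfBar.eq_of_abs_sub_lt_one f z y' 1 hy']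
  · change |z.1.1 1 - z.1.1 1| < 1
    rw [sub_self, abs_zero]
    exact one_pos

variable {f}

theorem eq_of_mem_coverJoin_stateCover {F : Finset Γ} {v : Set (ZfBar f)}
    (hv : v ∈ coverJoin (stateCover f) F) {z z' : ZfBar f} (hz : z ∈ v) (hz' : z' ∈ v)
    {g : Γ} (hg : g ∈ F) : z'.1.1 g⁻¹ = z.1.1 g⁻¹ := by
  obtain ⟨φ, hφ, rfl⟩ := hv
  have h := (hφ g hg).2 _ (Set.mem_iInter₂.1 hz g hg) _ (Set.mem_iInter₂.1 hz' g hg)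
  rwa [ZfBar.smul_apply, ZfBar.smul_apply, mul_one] at h

-- Points of the closure of `Y_f` over one member of the refined state cover differ on `A` by kernel
-- vectors of sup norm at most 1. An `ε`-net of these costs `(1 + 2 / ε) ^ dim`, which is
-- subexponential by `hdim`.
open scoped Classical in
theorem topEntropy_YfBar_le_topEntropy_ZfBar
    (hdim : ∀ (K : Finset Γ) (c : ℝ), 0 < c → ∀ᶠ F in leftFolnerFilter Γ,
      (Module.finrank ℝ (kerOn f (F⁻¹ * K) (F⁻¹ : Finset Γ)) : ℝ) ≤ c * F.card) :
    topEntropy Γ (YfBar f) ≤ topEntropy Γ (ZfBar f) := by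
  refine topEntropy_le_of_forall_cover fun U hU =>
    ⟨stateCover f, isOpenCoverOf_stateCover f, fun δ hδ => ?_⟩
  obtain ⟨K, ε, hε, hK⟩ := EllInf.exists_lebesgue (isCompact_YfBar f) hU
  -- The support is included so that coordinates in `F⁻¹ * K'` determine `ρ^f` on `F⁻¹`.
  let K' := K ∪ f.coeff.support
  have hlog : 0 < Real.log (1 + 2 / ε) := Real.log_pos (by
    have : 0 < 2 / ε := by positivity
    linarith)
  filter_upwards [hdim K' (δ / Real.log (1 + 2 / ε)) (by positivity)] with F hF
  refine minCoverCard_le_mul_of_subcovers (Real.exp_pos _) fun V hV hcov => ?_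
  let A := F⁻¹ * K'
  have hA : ∀ γ ∈ (F⁻¹ : Finset Γ), ∀ k ∈ K', γ * k ∈ A := fun γ hγ k hk =>
    Finset.mul_mem_mul hγ hk
  have hQ : (1 + 2 / ε) ^ Module.finrank ℝ (kerOn f A (F⁻¹ : Finset Γ)) ≤
      Real.exp (δ * F.card) := by
    rw [← Real.exp_log (by positivity : 0 < 1 + 2 / ε), ← Real.exp_nat_mul]
    refine Real.exp_le_exp.2 ((mul_le_mul_of_nonneg_right hF hlog.le).trans_eq ?_)
    rw [div_mul_eq_mul_div, div_mul_cancel₀ _ hlog.ne']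
  let ρ : YfBar f → ZfBar f := fun y => ⟨rhoBar f y.1, rhoBar_mem_ZfBar f y.2⟩
  have hD : ∀ v ∈ V, ∃ D : Finset (YfBar f), (D.card : ℝ) ≤ Real.exp (δ * F.card) ∧
      ∀ y, ρ y ∈ v → ∃ d ∈ D, ∀ a ∈ A, |y.1.1 a - d.1.1 a| < ε := by
    intro v hv
    by_cases hne : ∃ y₀, ρ y₀ ∈ v
    · obtain ⟨y₀, hy₀⟩ := hne
      have hmem : ∀ y : {y // ρ y ∈ v}, (fun a : A => (y.1.1.1 - y₀.1.1) a) ∈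
          kerOn f A (F⁻¹ : Finset Γ) := by
        intro y
        refine restrict_mem_kerOn
          (fun γ hγ δ' hδ' => hA γ hγ δ' (Finset.mem_union_right _ hδ')) fun γ hγ => ?_
        have h := eq_of_mem_coverJoin_stateCover (hV hv) hy₀ y.2
          (Finset.mem_inv'.1 (Finset.mem_coe.1 hγ))
        rw [inv_inv] at h
        rw [rightConv_sub, Pi.sub_apply, sub_eq_zero]
        exact h
      obtain ⟨D, -, hDc, hDd⟩ := exists_finset_dense_of_finrank hε
        (Set.univ : Set {y // ρ y ∈ v})
        (fun y => (⟨_, hmem y⟩ : kerOn f A (F⁻¹ : Finset Γ))) (fun y _ => by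
          refine (pi_norm_le_iff_of_nonneg zero_le_one).2 fun a => ?_
          have h1 := mem_Icc_of_mem_YfBar f y.1.2 a
          have h2 := mem_Icc_of_mem_YfBar f y₀.2 a
          change |y.1.1.1 a - y₀.1.1 a| ≤ 1
          rw [abs_le]
          constructor <;> linarith [h1.1, h1.2, h2.1, h2.2])
      refine ⟨D.image Subtype.val, ?_, fun y hy => ?_⟩
      · refine le_trans ?_ (hDc.trans hQ)
        exact_mod_cast Finset.card_image_le
      · obtain ⟨d, hd, hyd⟩ := hDd ⟨y, hy⟩ (Set.mem_univ _)
        refine ⟨d.1, Finset.mem_image_of_mem _ hd, fun a ha => ?_⟩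
        have h := (dist_le_pi_dist (fun a : A => (y.1.1 - y₀.1.1) a)
          (fun a : A => (d.1.1.1 - y₀.1.1) a) ⟨a, ha⟩).trans_lt hyd
        rw [Real.dist_eq] at h
        simpa using h
    · exact ⟨∅, by simpa using (Real.exp_pos _).le, fun y hy => absurd ⟨y, hy⟩ hne⟩
  choose! D hDc hDd using hD
  refine minCoverCard_le_card_mul V D (fun _ d => {y | ∀ a ∈ A, |y.1.1 a - d.1.1 a| < ε}) _ hDc
    (fun y => ?_) fun v hv d hd _ => ?_
  · obtain ⟨v, hv, hyv⟩ : ρ y ∈ ⋃₀ (V : Set (Set (ZfBar f))) := hcov ▸ Set.mem_univ _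
    obtain ⟨d, hd, hyd⟩ := hDd v hv y hyv
    exact ⟨v, hv, d, hd, hyd⟩
  · choose φ hφU hφ using fun γ : Γ => hK (γ • d)
    refine ⟨_, ⟨φ, fun γ _ => hφU γ, rfl⟩, fun y hy => Set.mem_iInter₂.2 fun γ hγ => ?_⟩
    refine hφ γ (γ • y) fun k hk => ?_
    rw [YfBar.smul_apply, YfBar.smul_apply]
    exact hy _ (hA _ (Finset.inv_mem_inv hγ) k (Finset.mem_union_left _ hk))

/-! ### Rounding differences -/

/-- The difference of two functions, reduced modulo `1` to a function of smallest modulus. -/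
def reducedDiff (y y' : Γ → ℝ) : Γ → ℝ := fun γ => y' γ - y γ - round (y' γ - y γ)

/-- The value is an integer, since `ρ^f y`, `ρ^f y'` and `ρ^f` of the rounding are, and its modulus
is below 1. -/
theorem rightConv_reducedDiff_eq_zero {y y' : EllInf Γ} (hy : y ∈ Yf f) (hy' : y' ∈ Yf f)
    {ε : ℝ} (hε : ellOneNorm f * ε < 1) {γ : Γ}
    (h : ∀ δ ∈ f.coeff.support, |reducedDiff y.1 y'.1 (γ * δ)| ≤ ε) :
    rightConv f (reducedDiff y.1 y'.1) γ = 0 := by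
  have hlt := (abs_rightConv_le f _ γ h).trans_lt hε
  obtain ⟨n, hn⟩ := (coe_mem_Xf_iff f y.1).1 hy.1 γ
  obtain ⟨n', hn'⟩ := (coe_mem_Xf_iff f y'.1).1 hy'.1 γ
  have heq : reducedDiff y.1 y'.1 =
      y'.1 - y.1 - fun γ => ((round (y'.1 γ - y.1 γ) : ℤ) : ℝ) := rfl
  rw [heq, rightConv_sub, rightConv_sub, Pi.sub_apply, Pi.sub_apply, rightConv_intCast, ← hn,
    ← hn'] at hlt ⊢
  have hlt' : |n' - n - rightConv f (fun γ => round (y'.1 γ - y.1 γ)) γ| < 1 := by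
    exact_mod_cast hlt
  rw [Int.abs_lt_one_iff] at hlt'
  exact_mod_cast hlt'

theorem rightConv_eq_add_round {y y' : Γ → ℝ} {γ : Γ}
    (h : rightConv f (reducedDiff y y') γ = 0) :
    rightConv f y' γ =
      rightConv f y γ + (rightConv f (fun γ => round (y' γ - y γ)) γ : ℤ) := by
  have heq : y' = y + reducedDiff y y' + fun γ => ((round (y' γ - y γ) : ℤ) : ℝ) := by
    funext γ
    simp only [Pi.add_apply, reducedDiff]
    ring
  conv_lhs => rw [heq]
  rw [rightConv_add, rightConv_add, Pi.add_apply, Pi.add_apply, h, rightConv_intCast, add_zero]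

/-- The integer carried when a small number is added to a point of `[0,1)` is determined by two
comparisons. -/
theorem carry_eq_carry {y w₁ w₂ : ℝ} {m₁ m₂ : ℤ} (hy : y ∈ Set.Ico (0 : ℝ) 1)
    (hw₁ : |w₁| < 1) (hw₂ : |w₂| < 1) (h₁ : y + w₁ + m₁ ∈ Set.Ico (0 : ℝ) 1)
    (h₂ : y + w₂ + m₂ ∈ Set.Ico (0 : ℝ) 1) (h0 : -y ≤ w₁ ↔ -y ≤ w₂)
    (h1 : 1 - y ≤ w₁ ↔ 1 - y ≤ w₂) : m₁ = m₂ := by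
  have key : ∀ (w : ℝ) (m : ℤ), |w| < 1 → y + w + m ∈ Set.Ico (0 : ℝ) 1 →
      m = if 1 - y ≤ w then -1 else if -y ≤ w then 0 else 1 := by
    rintro w m hw ⟨hm0, hm1⟩
    obtain ⟨hw0, hw1⟩ := abs_lt.1 hw
    obtain ⟨hy0, hy1⟩ := hy
    have hint : ∀ n : ℤ, (n : ℝ) - 1 < m → (m : ℝ) < n + 1 → m = n := by
      intro n ha hb
      have ha' : n - 1 < m := by exact_mod_cast ha
      have hb' : m < n + 1 := by exact_mod_cast hb
      omega
    split_ifs with ha hb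
    · exact hint (-1) (by push_cast; linarith) (by push_cast; linarith)
    · exact hint 0 (by push_cast; linarith) (by push_cast; linarith)
    · exact hint 1 (by push_cast; linarith) (by push_cast; linarith)
  rw [key w₁ m₁ hw₁ h₁, key w₂ m₂ hw₂ h₂]
  simp only [h0, h1]

/-! ### Counting carries, and the conclusion -/

-- Inside one member of the refined cover of `X_f`, the values of `z` on `F⁻¹ * K` depend only on
-- the carries relative to a base point `b v`. These are encoded by two threshold patterns of a
-- vector in `W`.
open scoped Classical in
theorem topEntropy_ZfBar_le_topEntropy_Xf
    (hdim : ∀ (K : Finset Γ) (c : ℝ), 0 < c → ∀ᶠ F in leftFolnerFilter Γ,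
      (Module.finrank ℝ (kerOn f (F⁻¹ * K) (F⁻¹ : Finset Γ)) : ℝ) ≤ c * F.card) :
    topEntropy Γ (ZfBar f) ≤ topEntropy Γ (Xf f) := by
  refine topEntropy_le_of_forall_cover fun U hU => ?_
  obtain ⟨K₀, ε₀, hε₀, hK₀⟩ := EllInf.exists_lebesgue (isCompact_ZfBar f) hU
  -- Containing `1` gives `F⁻¹ ⊆ F⁻¹ * K`, which puts the reduced differences in `W`.
  let K := insert 1 K₀
  let K' := K * f.coeff.support
  have hnorm := ellOneNorm_nonneg f
  let ε : ℝ := 1 / (ellOneNorm f + 1)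
  have hε : 0 < ε := by positivity
  have hε1 : ε ≤ 1 := by
    simp only [ε]
    rw [div_le_one (by positivity)]
    linarith
  have hεf : ellOneNorm f * ε < 1 := by
    simp only [ε]
    rw [mul_one_div, div_lt_one (by positivity)]
    linarith
  refine ⟨closeCover f K' ε, isOpenCoverOf_closeCover f K' hε, fun δ hδ => ?_⟩
  -- Both Sauer–Shelah terms, `τ * |A|` and `dim W * log (1 / τ)`, become at most `(δ / 4) * |F|`;
  -- the two threshold families together use up `δ * |F|`.
  let τ : ℝ := min 1 (δ / (4 * (K'.card + 1)))
  have hτ : 0 < τ := lt_min one_pos (by positivity)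
  have hτ1 : τ ≤ 1 := min_le_left _ _
  have hlog : 0 ≤ Real.log (1 / τ) := Real.log_nonneg (by rwa [le_div_iff₀ hτ, one_mul])
  filter_upwards [hdim K' (δ / (4 * (Real.log (1 / τ) + 1))) (by positivity)] with F hF
  refine minCoverCard_le_mul_of_subcovers (Real.exp_pos _) fun V hV hcov => ?_
  let A := F⁻¹ * K'
  let W := kerOn f A (F⁻¹ : Finset Γ)
  have hA : ∀ γ ∈ F⁻¹ * K, ∀ s ∈ f.coeff.support, γ * s ∈ A := by
    intro γ hγ s hs
    obtain ⟨g, hg, k, hk, rfl⟩ := Finset.mem_mul.1 hγ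
    rw [mul_assoc]
    exact Finset.mul_mem_mul hg (Finset.mul_mem_mul hk hs)
  have hFK : ∀ γ ∈ (F⁻¹ : Finset Γ), γ ∈ F⁻¹ * K := fun γ hγ => by
    have := Finset.mul_mem_mul hγ (Finset.mem_insert_self 1 K₀)
    rwa [mul_one] at this
  have hcount : ∀ t t' : A → ℝ,
      ((thresholdSets W t ×ˢ thresholdSets W t').card : ℝ) ≤ Real.exp (δ * F.card) := by
    intro t t'
    have hAcard : (Fintype.card A : ℝ) ≤ F.card * K'.card := by
      rw [Fintype.card_coe, ← Finset.card_inv F]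
      exact_mod_cast Finset.card_mul_le
    have h1 : τ * Fintype.card A ≤ δ / 4 * F.card := by
      have h2 : τ * (K'.card + 1) ≤ δ / 4 := by
        have := min_le_right 1 (δ / (4 * ((K'.card : ℝ) + 1)))
        rw [le_div_iff₀ (by positivity)] at this
        linarith
      have h3 : τ * K'.card ≤ δ / 4 := by linarith
      calc τ * Fintype.card A ≤ τ * (F.card * K'.card) := mul_le_mul_of_nonneg_left hAcard hτ.le
        _ = τ * K'.card * F.card := by ring
        _ ≤ _ := mul_le_mul_of_nonneg_right h3 (Nat.cast_nonneg _)
    have h2 : Module.finrank ℝ W * Real.log (1 / τ) ≤ δ / 4 * F.card := by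
      calc Module.finrank ℝ W * Real.log (1 / τ)
          ≤ Module.finrank ℝ W * (Real.log (1 / τ) + 1) :=
            mul_le_mul_of_nonneg_left (by linarith) (Nat.cast_nonneg _)
        _ ≤ δ / (4 * (Real.log (1 / τ) + 1)) * F.card * (Real.log (1 / τ) + 1) :=
            mul_le_mul_of_nonneg_right hF (by linarith)
        _ = _ := by field_simp
    have h3 := card_thresholdSets_le W t hτ hτ1
    have h4 := card_thresholdSets_le W t' hτ hτ1
    rw [Finset.card_product, Nat.cast_mul]
    refine (mul_le_mul h3 h4 (Nat.cast_nonneg _) (Real.exp_pos _).le).trans ?_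
    rw [← Real.exp_add]
    have h5 : 0 ≤ δ * F.card := by positivity
    exact Real.exp_le_exp.2 (by linarith)
  have hbase : ∀ v ∈ V, (∃ y ∈ Yf f, ∃ x ∈ v, x.1 = etaMap y) →
      ∃ y, y ∈ Yf f ∧ ∃ x ∈ v, x.1 = etaMap y := fun v _ h => h
  -- A default for `b v` when `v` contains no image of a point of `Y_f`.
  have : Nonempty (EllInf Γ) := ⟨⟨0, zero_memℓp⟩⟩
  choose! b hbY hbv using hbase
  have hsmall : ∀ v ∈ V, ∀ y' ∈ Yf f, (∃ x ∈ v, x.1 = etaMap y') →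
      ∀ a ∈ A, |reducedDiff (b v).1 y'.1 a| < ε := by
    rintro v hv y' hy' ⟨x', hx', hxy'⟩ a ha
    obtain ⟨x, hx, hxy⟩ := hbv v hv ⟨y', hy', x', hx', hxy'⟩
    obtain ⟨g, hg, k, hk, rfl⟩ := Finset.mem_mul.1 ha
    have h := norm_sub_lt_of_mem_coverJoin_closeCover (hV hv) hx hx' (Finset.mem_inv'.1 hg) hk
    rw [inv_inv, hxy, hxy'] at h
    change ‖((y'.1 (g * k) : ℝ) : UnitAddCircle) - (((b v).1 (g * k) : ℝ) : UnitAddCircle)‖ < ε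
      at h
    rwa [← AddCircle.coe_sub, UnitAddCircle.norm_eq] at h
  have hker : ∀ v ∈ V, ∀ y' ∈ Yf f, (∃ x ∈ v, x.1 = etaMap y') →
      ∀ γ ∈ F⁻¹ * K, rightConv f (reducedDiff (b v).1 y'.1) γ = 0 := by
    intro v hv y' hy' hx γ hγ
    exact rightConv_reducedDiff_eq_zero (hbY v hv ⟨y', hy', hx⟩) hy' hεf fun s hs =>
      (hsmall v hv y' hy' hx _ (hA γ hγ s hs)).le
  let key : Set (Xf f) → (Γ → ℝ) → Finset A × Finset A := fun v y' =>
    (Finset.univ.filter fun a : A => -(b v).1 a ≤ reducedDiff (b v).1 y' a,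
      Finset.univ.filter fun a : A => 1 - (b v).1 a ≤ reducedDiff (b v).1 y' a)
  refine minCoverCard_le_card_mul V
    (fun v => thresholdSets W (fun a => -(b v).1 a) ×ˢ thresholdSets W fun a => 1 - (b v).1 a)
    (fun v p => {z | ∃ y' ∈ Yf f, (∃ x ∈ v, x.1 = etaMap y') ∧
      (∀ γ ∈ F⁻¹ * K, rightConv f y'.1 γ = z.1.1 γ) ∧ key v y'.1 = p}) _
    (fun v _ => hcount _ _) (fun z => ?_) ?_
  · obtain ⟨y', hy', hyz⟩ := ZfBar.exists_Yf_eqOn f z (F⁻¹ * K)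
    obtain ⟨v, hv, hyv⟩ : (⟨etaMap y', hy'.1⟩ : Xf f) ∈ ⋃₀ (V : Set (Set (Xf f))) :=
      hcov ▸ Set.mem_univ _
    have hx : ∃ x ∈ v, x.1 = etaMap y' := ⟨_, hyv, rfl⟩
    have hmem : (fun a : A => reducedDiff (b v).1 y'.1 a) ∈ W :=
      restrict_mem_kerOn (fun γ hγ s hs => hA γ (hFK γ hγ) s hs)
        fun γ hγ => hker v hv y' hy' hx γ (hFK γ hγ)
    refine ⟨v, hv, key v y'.1, Finset.mem_product.2 ⟨?_, ?_⟩, y', hy', hx, hyz, rfl⟩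
    · exact Finset.mem_filter.2 ⟨Finset.mem_univ _, _, hmem, rfl⟩
    · exact Finset.mem_filter.2 ⟨Finset.mem_univ _, _, hmem, rfl⟩
  · rintro v hv p - ⟨z, y, hy, hyx, hyz, hyp⟩
    choose φ hφU hφ using fun γ : Γ => hK₀ (γ • z)
    refine ⟨_, ⟨φ, fun γ _ => hφU γ, rfl⟩, ?_⟩
    rintro z' ⟨y', hy', hyx', hyz', hyp'⟩
    -- The rounding is the carry `m` in `y' = b v + w + m`, and equal threshold patterns force equal
    -- carries.
    have hround : ∀ a ∈ A, round (y'.1 a - (b v).1 a) = round (y.1 a - (b v).1 a) := by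
      intro a ha
      obtain ⟨hp, hq⟩ := Prod.ext_iff.1 (hyp'.trans hyp.symm)
      have hp' := Finset.ext_iff.1 hp ⟨a, ha⟩
      have hq' := Finset.ext_iff.1 hq ⟨a, ha⟩
      simp only [key, Finset.mem_filter, Finset.mem_univ, true_and] at hp' hq'
      refine carry_eq_carry ((hbY v hv ⟨y, hy, hyx⟩).2 a)
        ((hsmall v hv y' hy' hyx' a ha).trans_le hε1)
        ((hsmall v hv y hy hyx a ha).trans_le hε1) ?_ ?_ hp' hq'
      · convert hy'.2 a using 1
        simp only [reducedDiff]
        ring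
      · convert hy.2 a using 1
        simp only [reducedDiff]
        ring
    have hzz : ∀ γ ∈ F⁻¹ * K, z'.1.1 γ = z.1.1 γ := by
      intro γ hγ
      rw [← hyz γ hγ, ← hyz' γ hγ, rightConv_eq_add_round (hker v hv y hy hyx γ hγ),
        rightConv_eq_add_round (hker v hv y' hy' hyx' γ hγ)]
      congr 2
      exact rightConv_congr f fun s hs => hround _ (hA γ hγ s hs)
    refine Set.mem_iInter₂.2 fun γ hγ => hφ γ (γ • z') fun k hk => ?_
    rw [ZfBar.smul_apply, ZfBar.smul_apply, hzz _ (Finset.mul_mem_mul (Finset.inv_mem_inv hγ)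
      (Finset.mem_insert_of_mem hk)), sub_self, abs_zero]
    exact hε₀

end Comparison

end

theorem theorem3p7 {Γ : Type*} [Group Γ] [Countable Γ] [Infinite Γ] (hΓ : IsAmenableGroup Γ)
    (f : MonoidAlgebra ℤ Γ) (hf : topEntropy Γ (Xf f) < ⊤) :
    topEntropy Γ (ZfBar f) = topEntropy Γ (YfBar f) ∧
      topEntropy Γ (YfBar f) = topEntropy Γ (Xf f) := by
  have hXY := topEntropy_Xf_le_topEntropy_YfBar f
  have hYZ := topEntropy_YfBar_le_topEntropy_ZfBar (f := f)
    fun K _ hc => eventually_finrank_kerOn_le hf K hc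
  have hZX := topEntropy_ZfBar_le_topEntropy_Xf (f := f)
    fun K _ hc => eventually_finrank_kerOn_le hf K hc
  exact ⟨le_antisymm (hZX.trans hXY) hYZ, le_antisymm (hYZ.trans hZX) hXY⟩
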